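/- Let $n, i \ge 0$ be integers with $n \ge 3i$. Let $F_n$ be the free group on $x_1,\dots,x_n$, let $IA_n$ be the kernel of $\mathrm{Aut}(F_n)\to \mathrm{GL}(n,\mathbb Z)$, i.e. the group of automorphisms of $F_n$ acting trivially on $H_1(F_n,\mathbb Z)$, let $H=H_1(F_n,\mathbb Q)$ and $U=\mathrm{Hom}(H,\bigwedge^2 H)\cong (\bigwedge^2 H)\otimes H^*$. The Albanese homology $H^A_i(IA_n,\mathbb Q)$ is the image of the map $H_i(IA_n,\mathbb Q)\to H_i(H_1(IA_n,\mathbb Z),\mathbb Q)$ induced by abelianization. It is regarded as a subspace of $H_i(U,\mathbb Q)\cong\bigwedge^i U$ through the map $H_i(H_1(IA_n,\mathbb Z),\mathbb Q)\to H_i(U,\mathbb Q)$ induced by the Johnson homomorphism $\tau: IA_n\to U$, where $\tau(\varphi)$ sends the class of $x\in F_n$ to the class of $\varphi(x)x^{-1}$ in $[F_n,F_n]/[F_n,[F_n,F_n]]\cong \bigwedge^2H_1(F_n,\mathbb Z)\subset \bigwedge^2H$. Let $T_{2i,i}\subset H^{\otimes 2i}\otimes (H^*)^{\otimes i}$ be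 the intersection of the kernels of all contraction maps $c_{k,l}$ ($1\le k\le 2i$, $1\le l\le i$), where $c_{k,l}$ pairs the $k$-th factor $H$ with the $l$-th factor $H^*$. Let $$\pi: H^{\otimes 2i}\otimes (H^*)^{\otimes i}\to \bigwedge^i U,\qquad \Bigl(\bigotimes_{j=1}^i (a_j\otimes b_j)\Bigr)\otimes\Bigl(\bigotimes_{j=1}^i c_j^*\Bigr)\mapsto \bigwedge_{j=1}^i \bigl((a_j\wedge b_j)\otimes c_j^*\bigr),$$ and let $H_i(U,\mathbb Q)^{\mathrm{tl}}=\pi(T_{2i,i})$ be the traceless part of $H_i(U,\mathbb Q)=\bigwedge^iU$. Then $$H_i(U,\mathbb Q)^{\mathrm{tl}}\subset H^A_i(IA_n,\mathbb Q)$$ as subspaces of $H_i(U,\mathbb Q)=\bigwedge^i U$. -/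

import Mathlib

noncomputable section

open CategoryTheory
open scoped TensorProduct

namespace AlbaneseIA

/-- The group `IA_n`: the automorphisms of the free group `F_n` that act trivially on the
abelianization of `F_n`, that is, the kernel of `Aut(F_n) → GL(n, ℤ)`. -/
def IA (n : ℕ) : Subgroup (MulAut (FreeGroup (Fin n))) where
  carrier := {φ | ∀ x, Abelianization.of (φ x) = Abelianization.of x}
  mul_mem' := by
    intro φ ψ hφ hψ x
    rw [MulAut.mul_apply, hφ, hψ]
  one_mem' := by
    intro x
    rfl
  inv_mem' := by
    intro φ hφ x
    have h := hφ (φ⁻¹ x)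
    rw [MulAut.apply_inv_self] at h
    exact h.symm

/-- `H = H_1(F_n, ℚ) = ℚ^n`, where the basis vector `e_j` is the class of the generator `x_j`. -/
abbrev H (n : ℕ) : Type := Fin n → ℚ

/-- `U = Hom(H, ⋀² H)`. -/
abbrev U (n : ℕ) : Type := H n →ₗ[ℚ] ⋀[ℚ]^2 (H n)

/-- The wedge product of two vectors, as a bilinear map `H × H → ⋀² H`. -/
def wedge (n : ℕ) : H n →ₗ[ℚ] H n →ₗ[ℚ] ⋀[ℚ]^2 (H n) :=
  have u0 : ∀ a b c : H n, Function.update ![a, b] 0 c = ![c, b] := by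
    intro a b c
    ext j : 1
    fin_cases j <;> simp
  have u1 : ∀ a b c : H n, Function.update ![a, b] 1 c = ![a, c] := by
    intro a b c
    ext j : 1
    fin_cases j <;> simp
  LinearMap.mk₂ ℚ (fun a b => exteriorPower.ιMulti ℚ 2 ![a, b])
    (fun a a' b => by
      simpa only [u0] using (exteriorPower.ιMulti ℚ 2).map_update_add ![a, b] 0 a a')
    (fun c a b => by
      simpa only [u0] using (exteriorPower.ιMulti ℚ 2).map_update_smul ![a, b] 0 c a)
    (fun a b b' => by
      simpa only [u1] using (exteriorPower.ιMulti ℚ 2).map_update_add ![a, b] 1 b b')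
    (fun c a b => by
      simpa only [u1] using (exteriorPower.ιMulti ℚ 2).map_update_smul ![a, b] 1 c b)

theorem wedge_self {n : ℕ} (a : H n) : wedge n a a = 0 :=
  (exteriorPower.ιMulti ℚ 2).map_eq_zero_of_eq ![a, a] (i := 0) (j := 1) rfl (by decide)

/-! ### The Johnson homomorphism -/

/-- The free rational two-step nilpotent group on `H`: the set `H × ⋀² H` with the product
`(h, a) (k, b) = (h + k, a + b + ½ h ∧ k)`. -/
@[ext]
structure Nil2 (n : ℕ) : Type where
  fst : H n
  snd : ⋀[ℚ]^2 (H n)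

instance (n : ℕ) : Mul (Nil2 n) :=
  ⟨fun x y => ⟨x.fst + y.fst, x.snd + y.snd + (1 / 2 : ℚ) • wedge n x.fst y.fst⟩⟩

instance (n : ℕ) : One (Nil2 n) := ⟨⟨0, 0⟩⟩

instance (n : ℕ) : Inv (Nil2 n) := ⟨fun x => ⟨-x.fst, -x.snd⟩⟩

@[simp] theorem Nil2.mul_fst {n : ℕ} (x y : Nil2 n) : (x * y).fst = x.fst + y.fst := rfl

@[simp] theorem Nil2.mul_snd {n : ℕ} (x y : Nil2 n) :
    (x * y).snd = x.snd + y.snd + (1 / 2 : ℚ) • wedge n x.fst y.fst := rfl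

@[simp] theorem Nil2.one_fst {n : ℕ} : (1 : Nil2 n).fst = 0 := rfl

@[simp] theorem Nil2.one_snd {n : ℕ} : (1 : Nil2 n).snd = 0 := rfl

@[simp] theorem Nil2.inv_fst {n : ℕ} (x : Nil2 n) : (x⁻¹).fst = -x.fst := rfl

@[simp] theorem Nil2.inv_snd {n : ℕ} (x : Nil2 n) : (x⁻¹).snd = -x.snd := rfl

instance (n : ℕ) : Group (Nil2 n) :=
  Group.ofLeftAxioms
    (fun x y z => by
      ext1
      · simp [add_assoc]
      · simp only [Nil2.mul_snd, Nil2.mul_fst, map_add, LinearMap.add_apply, smul_add]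
        abel)
    (fun x => by ext1 <;> simp)
    (fun x => by ext1 <;> simp [wedge_self])

/-- The homomorphism from `F_n` with `x_j ↦ (e_j, 0)`. It sends a commutator `[x, y]` to
`(0, [x] ∧ [y])`, so its second component restricts to the canonical map
`[F_n, F_n] → [F_n, F_n] / [F_n, [F_n, F_n]] = ⋀² H_1(F_n, ℤ) ⊆ ⋀² H`. -/
def toNil2 (n : ℕ) : FreeGroup (Fin n) →* Nil2 n :=
  FreeGroup.lift fun j => ⟨Pi.single j 1, 0⟩

/-- The class in `H` of an element of `F_n`. -/
def cls (n : ℕ) : FreeGroup (Fin n) →* Multiplicative (H n) :=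
  FreeGroup.lift fun j => Multiplicative.ofAdd (Pi.single j 1)

theorem toNil2_fst {n : ℕ} (x : FreeGroup (Fin n)) :
    (toNil2 n x).fst = (cls n x).toAdd := by
  let p : Nil2 n →* Multiplicative (H n) :=
    { toFun := fun y => Multiplicative.ofAdd y.fst
      map_one' := rfl
      map_mul' := fun _ _ => rfl }
  have h : p.comp (toNil2 n) = cls n := by
    ext j : 1
    simp [p, toNil2, cls]
  exact congrArg Multiplicative.toAdd (DFunLike.congr_fun h x)

/-- A commutator is sent to the wedge product of the two classes. -/
theorem toNil2_commutator {n : ℕ} (x y : FreeGroup (Fin n)) :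
    toNil2 n (x * y * x⁻¹ * y⁻¹) = ⟨0, wedge n (cls n x).toAdd (cls n y).toAdd⟩ := by
  have hw : ∀ a b : H n, wedge n b a = -wedge n a b := by
    intro a b
    have h := wedge_self (a + b)
    simp only [map_add, LinearMap.add_apply, wedge_self, zero_add, add_zero] at h
    exact eq_neg_of_add_eq_zero_left h
  rw [← toNil2_fst, ← toNil2_fst]
  ext1
  · simp
  · simp only [map_mul, map_inv, Nil2.mul_snd, Nil2.mul_fst, Nil2.inv_fst, Nil2.inv_snd, map_add,
      map_neg, LinearMap.add_apply, LinearMap.neg_apply, wedge_self, hw (toNil2 n x).fst (toNil2 n y).fst]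
    module

theorem cls_IA {n : ℕ} (φ : IA n) (x : FreeGroup (Fin n)) : cls n (φ.1 x) = cls n x := by
  have h := congrArg (Abelianization.lift (cls n)) (φ.2 x)
  simpa using h

/-- `τ_φ(x)` is the class of `φ(x) x⁻¹ ∈ [F_n, F_n]` in `⋀² H`; it is additive in `x`. -/
def johnsonFree {n : ℕ} (φ : IA n) : FreeGroup (Fin n) →* Multiplicative (⋀[ℚ]^2 (H n)) where
  toFun x := Multiplicative.ofAdd (toNil2 n (φ.1 x * x⁻¹)).snd
  map_one' := by simp
  map_mul' x y := by
    rw [← ofAdd_add]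
    congr 1
    simp only [map_mul, map_inv, mul_inv_rev, Nil2.mul_snd, Nil2.mul_fst, Nil2.inv_fst,
      Nil2.inv_snd, toNil2_fst, cls_IA, map_add, map_neg, LinearMap.add_apply,
      LinearMap.neg_apply, wedge_self]
    module

/-- The Johnson homomorphism as a function: `τ(φ) ∈ U = Hom(H, ⋀² H)` sends the class of `x_j` to
the class of `φ(x_j) x_j⁻¹`. -/
def johnsonFun {n : ℕ} (φ : IA n) : U n :=
  (Pi.basisFun ℚ (Fin n)).constr ℚ fun j => (johnsonFree φ (FreeGroup.of j)).toAdd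

/-- `τ(φ)` sends the class of any `x ∈ F_n` to the class of `φ(x) x⁻¹`. -/
theorem johnsonFun_cls {n : ℕ} (φ : IA n) (x : FreeGroup (Fin n)) :
    johnsonFun φ (cls n x).toAdd = (toNil2 n (φ.1 x * x⁻¹)).snd := by
  have h : (AddMonoidHom.toMultiplicative (johnsonFun φ).toAddMonoidHom).comp (cls n)
      = johnsonFree φ := by
    ext j : 1
    have : johnsonFun φ (Pi.single j 1) = (johnsonFree φ (FreeGroup.of j)).toAdd := by
      have := (Pi.basisFun ℚ (Fin n)).constr_basis ℚ
        (fun j => (johnsonFree φ (FreeGroup.of j)).toAdd) j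
      rwa [Pi.basisFun_apply] at this
    simp [cls, this]
  exact congrArg Multiplicative.toAdd (DFunLike.congr_fun h x)

theorem toNil2_IA_snd {n : ℕ} (φ : IA n) (x : FreeGroup (Fin n)) :
    (toNil2 n (φ.1 x)).snd = johnsonFun φ (cls n x).toAdd + (toNil2 n x).snd := by
  rw [johnsonFun_cls]
  simp [toNil2_fst, cls_IA, wedge_self]

/-- The Johnson homomorphism `τ : IA_n → U = Hom(H, ⋀² H)`. -/
def johnson (n : ℕ) : IA n →* Multiplicative (U n) where
  toFun φ := Multiplicative.ofAdd (johnsonFun φ)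
  map_one' := by
    rw [ofAdd_eq_one]
    refine (Pi.basisFun ℚ (Fin n)).ext fun j => ?_
    have h := johnsonFun_cls (1 : IA n) (FreeGroup.of j)
    simpa [cls] using h
  map_mul' φ ψ := by
    rw [← ofAdd_add]
    congr 1
    refine (Pi.basisFun ℚ (Fin n)).ext fun j => ?_
    have h := toNil2_IA_snd (φ * ψ) (FreeGroup.of j)
    have h' : (φ * ψ).1 (FreeGroup.of j) = φ.1 (ψ.1 (FreeGroup.of j)) := rfl
    rw [h', toNil2_IA_snd, toNil2_IA_snd, cls_IA, ← add_assoc] at h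
    have h2 := (add_right_cancel h).symm
    simpa [cls] using h2

/-! ### Albanese homology -/

/-- The rational group homology `H_i(G, ℚ)`, with trivial coefficients. -/
abbrev rationalHomology (G : Type) [Group G] (i : ℕ) : ModuleCat ℚ :=
  groupHomology (Rep.trivial ℚ G ℚ) i

/-- The map `H_i(G, ℚ) → H_i(G', ℚ)` induced by a group homomorphism `f : G → G'`. -/
def rationalHomologyMap {G G' : Type} [Group G] [Group G'] (f : G →* G') (i : ℕ) :
    rationalHomology G i →ₗ[ℚ] rationalHomology G' i :=
  (groupHomology.map (A := Rep.trivial ℚ G ℚ) (B := Rep.trivial ℚ G' ℚ) f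
    (Rep.ofHom ⟨LinearMap.id, fun _ => rfl⟩) i).hom

/-- The Albanese homology `H^A_i(G, ℚ)`: the image of the map `H_i(G, ℚ) → H_i(G^ab, ℚ)` induced by
the abelianization map. -/
def albaneseHomology (G : Type) [Group G] (i : ℕ) :
    Submodule ℚ (rationalHomology (Abelianization G) i) :=
  LinearMap.range (rationalHomologyMap (Abelianization.of (G := G)) i)

section Exterior

variable (V : Type) [AddCommGroup V] [Module ℚ V]

/-- The map from inhomogeneous `i`-chains of the additive group of `V` to `⋀^i V` with
`[v_1 | ⋯ | v_i] ↦ (1 / i!) v_1 ∧ ⋯ ∧ v_i`. -/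
def chainsToExterior (i : ℕ) :
    ((Fin i → Multiplicative V) →₀ ℚ) →ₗ[ℚ] ⋀[ℚ]^i V :=
  Finsupp.linearCombination ℚ fun g =>
    ((i.factorial : ℚ)⁻¹) • exteriorPower.ιMulti ℚ i fun j => (g j).toAdd

/-- The map above vanishes on boundaries. -/
theorem chainsToExterior_boundary (i : ℕ) (g : Fin (i + 1) → Multiplicative V) :
    (exteriorPower.ιMulti ℚ i fun k => (g k.succ).toAdd) +
      ∑ j : Fin (i + 1), (-1 : ℚ) ^ ((j : ℕ) + 1) •
        exteriorPower.ιMulti ℚ i (fun k => (Fin.contractNth j (· * ·) g k).toAdd) = 0 := by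
  let A : Fin (i + 1) → ⋀[ℚ]^i V := fun j =>
    exteriorPower.ιMulti ℚ i fun k => (g (j.succAbove k)).toAdd
  have hlast : exteriorPower.ιMulti ℚ i
      (fun k => (Fin.contractNth (Fin.last i) (· * ·) g k).toAdd) = A (Fin.last i) := by
    congr 1
    funext k
    rw [Fin.contractNth_apply_of_ne]
    simpa using k.2.ne'
  have hmid : ∀ m : Fin i, exteriorPower.ιMulti ℚ i
      (fun k => (Fin.contractNth m.castSucc (· * ·) g k).toAdd) = A m.succ + A m.castSucc := by
    intro m
    let B : Fin i → V := fun k => (g (m.castSucc.succAbove k)).toAdd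
    have h1 : (fun k => (Fin.contractNth m.castSucc (· * ·) g k).toAdd) =
        Function.update B m ((g m.castSucc).toAdd + (g m.succ).toAdd) := by
      funext k
      by_cases hk : k = m
      · subst hk
        rw [Fin.contractNth_apply_of_eq _ _ _ _ rfl]
        simp
      · rw [Function.update_of_ne hk, Fin.contractNth_apply_of_ne]
        simpa [Fin.ext_iff] using fun h => hk (Fin.ext h.symm)
    have h2 : Function.update B m (g m.castSucc).toAdd =
        fun k => (g (m.succ.succAbove k)).toAdd := by
      funext k
      by_cases hk : k = m
      · subst hk
        simp
      · rw [Function.update_of_ne hk]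
        rcases lt_or_gt_of_ne hk with h | h
        · simp only [B]
          rw [Fin.succAbove_of_castSucc_lt _ _ (by simpa using h),
            Fin.succAbove_of_castSucc_lt _ _ (by
              rw [Fin.lt_def] at h ⊢
              simp
              omega)]
        · simp only [B]
          rw [Fin.succAbove_of_le_castSucc _ _ (by simpa using h.le),
            Fin.succAbove_of_le_castSucc _ _ (by
              rw [Fin.lt_def] at h
              rw [Fin.le_def]
              simp
              omega)]
    have h3 : Function.update B m (g m.succ).toAdd = B := by
      rw [Function.update_eq_self_iff]
      simp [B]
    rw [h1, AlternatingMap.map_update_add, h2, h3]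
  have hfirst : (exteriorPower.ιMulti ℚ i fun k => (g k.succ).toAdd) = A 0 := by
    simp [A]
  rw [Fin.sum_univ_castSucc, hlast, hfirst]
  simp only [hmid, Fin.val_castSucc, Fin.val_last]
  have key : ∀ (m : ℕ) (C : Fin (m + 1) → ⋀[ℚ]^i V),
      C 0 + ((∑ j : Fin m, (-1 : ℚ) ^ ((j : ℕ) + 1) • (C j.succ + C j.castSucc)) +
        (-1 : ℚ) ^ (m + 1) • C (Fin.last m)) = 0 := by
    intro m
    induction m with
    | zero =>
      intro C
      simp only [Finset.univ_eq_empty, Finset.sum_empty, zero_add, pow_one, Fin.last_zero]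
      module
    | succ m ih =>
      intro C
      have h := ih fun j => C j.castSucc
      rw [Fin.sum_univ_castSucc]
      simp only [Fin.val_castSucc, Fin.val_last, Fin.succ_last, ← Fin.castSucc_succ,
        Fin.castSucc_zero] at h ⊢
      rw [← h]
      simp only [pow_succ]
      module
  exact key i A

/-- The isomorphism `H_i(V, ℚ) ≅ ⋀^i V` for the additive group of a rational vector space `V`, as a
linear map: the class of a cycle `∑ q [v_1 | ⋯ | v_i]` is sent to
`(1 / i!) ∑ q v_1 ∧ ⋯ ∧ v_i`. The factor makes it inverse to the map sending `v_1 ∧ ⋯ ∧ v_i` to the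
Pontryagin product of the classes `[v_j]`, which is the class of
`∑_σ sgn(σ) [v_σ(1) | ⋯ | v_σ(i)]`. -/
def homologyToExterior (i : ℕ) :
    rationalHomology (Multiplicative V) i →ₗ[ℚ] ⋀[ℚ]^i V :=
  ((groupHomology.inhomogeneousChains (Rep.trivial ℚ (Multiplicative V) ℚ)).homologyι i ≫
    (groupHomology.inhomogeneousChains (Rep.trivial ℚ (Multiplicative V) ℚ)).descOpcycles
      (A := ModuleCat.of ℚ (⋀[ℚ]^i V)) (ModuleCat.ofHom (chainsToExterior V i)) (i + 1) (by simp)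
      (by
        rw [groupHomology.inhomogeneousChains.d_def]
        ext g
        have h := congrArg (fun z => ((((i.factorial : ℚ)⁻¹) • z : ⋀[ℚ]^i V) :
          ExteriorAlgebra ℚ V)) (chainsToExterior_boundary V i g)
        simpa [chainsToExterior, groupHomology.inhomogeneousChains.d, smul_add, Finset.smul_sum,
          smul_comm ((i.factorial : ℚ)⁻¹)] using h)).hom

end Exterior

/-- The homomorphism `H_1(IA_n, ℤ) = IA_n^ab → U` induced by the Johnson homomorphism. -/
def johnsonAb (n : ℕ) : Abelianization (IA n) →* Multiplicative (U n) :=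
  Abelianization.lift (A := Multiplicative (U n)) (johnson n)

/-- The comparison map
`H_i(H_1(IA_n, ℤ), ℚ) → H_i(U, ℚ) ≅ ⋀^i U`
induced by the Johnson homomorphism. -/
def johnsonExterior (n i : ℕ) :
    rationalHomology (Abelianization (IA n)) i →ₗ[ℚ] ⋀[ℚ]^i (U n) :=
  homologyToExterior (U n) i ∘ₗ rationalHomologyMap (johnsonAb n) i

/-- `H^A_i(IA_n, ℚ)` as a subspace of `⋀^i U = H_i(U, ℚ)`, through the Johnson homomorphism. -/
def albaneseIA (n i : ℕ) : Submodule ℚ (⋀[ℚ]^i (U n)) :=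
  (albaneseHomology (IA n) i).map (johnsonExterior n i)

/-! ### The traceless part -/

section Contraction

variable {ι κ : Type}

/-- `v_1 ⊗ ⋯ ⊗ v_p ↦ v_k ⊗ (v_1 ⊗ ⋯ v̂_k ⋯ ⊗ v_p)`, for tensors indexed by a type `ι`. -/
def extract (M : Type) [AddCommGroup M] [Module ℚ M] (k : ι) :
    (⨂[ℚ] _ : ι, M) →ₗ[ℚ] M ⊗[ℚ] (⨂[ℚ] _ : {a : ι // a ≠ k}, M) :=
  have u1 : ∀ (inst : DecidableEq ι) (v : ι → M) (x : M),
      (fun a : {a : ι // a ≠ k} => Function.update v k x a) =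
        fun a : {a : ι // a ≠ k} => v a := by
    intro _ v x
    funext a
    exact Function.update_of_ne a.2 _ _
  have u2 : ∀ (inst : DecidableEq ι) (m : ι) (h : m ≠ k) (v : ι → M) (x : M),
      (fun a : {a : ι // a ≠ k} => Function.update v m x a) =
        Function.update (fun a : {a : ι // a ≠ k} => v a) ⟨m, h⟩ x := by
    intro _ m h v x
    funext a
    by_cases ha : a = ⟨m, h⟩
    · subst ha
      simp
    · rw [Function.update_of_ne ha, Function.update_of_ne fun e => ha (Subtype.ext e)]
  PiTensorProduct.lift
    { toFun := fun v => v k ⊗ₜ[ℚ] PiTensorProduct.tprod ℚ fun a : {a : ι // a ≠ k} => v a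
      map_update_add' := by
        intro _ v m x y
        by_cases h : m = k
        · subst h
          simp [u1, TensorProduct.add_tmul]
        · simp [u2 _ m h, Function.update_of_ne (Ne.symm h), TensorProduct.tmul_add]
      map_update_smul' := by
        intro _ v m c x
        by_cases h : m = k
        · subst h
          simp [u1, TensorProduct.smul_tmul']
        · simp [u2 _ m h, Function.update_of_ne (Ne.symm h)] }

/-- The contraction map
`c_{k,l} : H^{⊗ p} ⊗ (H^*)^{⊗ q} → H^{⊗ (p - 1)} ⊗ (H^*)^{⊗ (q - 1)}`, which pairs the `k`-th factor
`v_k ∈ H` with the `l`-th factor `f_l ∈ H^*` and omits both. The factors are indexed by types `ι` and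
`κ` with `p` and `q` elements. -/
def contraction (n : ℕ) (k : ι) (l : κ) :
    (⨂[ℚ] _ : ι, H n) ⊗[ℚ] (⨂[ℚ] _ : κ, Module.Dual ℚ (H n)) →ₗ[ℚ]
      (⨂[ℚ] _ : {a : ι // a ≠ k}, H n) ⊗[ℚ]
        (⨂[ℚ] _ : {b : κ // b ≠ l}, Module.Dual ℚ (H n)) :=
  (TensorProduct.lid ℚ _).toLinearMap ∘ₗ
    TensorProduct.map (contractRight ℚ (H n)) LinearMap.id ∘ₗ
      (TensorProduct.tensorTensorTensorComm ℚ _ _ _ _).toLinearMap ∘ₗ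
        TensorProduct.map (extract (H n) k) (extract (Module.Dual ℚ (H n)) l)

theorem contraction_tprod (n : ℕ) (k : ι) (l : κ) (v : ι → H n) (f : κ → Module.Dual ℚ (H n)) :
    contraction n k l (PiTensorProduct.tprod ℚ v ⊗ₜ[ℚ] PiTensorProduct.tprod ℚ f) =
      f l (v k) • ((PiTensorProduct.tprod ℚ fun a : {a : ι // a ≠ k} => v a) ⊗ₜ[ℚ]
        (PiTensorProduct.tprod ℚ fun b : {b : κ // b ≠ l} => f b)) := by
  simp [contraction, extract]

variable (ι κ)

/-- The traceless part `T_{p,q}` of `H^{⊗ p} ⊗ (H^*)^{⊗ q}`: the intersection of the kernels of all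
contraction maps. -/
def traceless (n : ℕ) :
    Submodule ℚ ((⨂[ℚ] _ : ι, H n) ⊗[ℚ] (⨂[ℚ] _ : κ, Module.Dual ℚ (H n))) :=
  ⨅ (k : ι) (l : κ), LinearMap.ker (contraction n k l)

end Contraction

section Projection

variable {C M V : Type} [AddCommGroup C] [Module ℚ C] [AddCommGroup M] [Module ℚ M]
  [AddCommGroup V] [Module ℚ V]

/-- For a trilinear map `e`, the multilinear map `(a_j, b_j)_j ↦ ⋀_j e(c_j, a_j, b_j)` with fixed
`c_j`, where `a_j = v (j, 0)` and `b_j = v (j, 1)`. -/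
def wedgeVec (e : C →ₗ[ℚ] M →ₗ[ℚ] M →ₗ[ℚ] V) (i : ℕ) (c : Fin i → C) :
    MultilinearMap ℚ (fun _ : Fin i × Fin 2 => M) (⋀[ℚ]^i V) :=
  have u0 : ∀ (inst : DecidableEq (Fin i × Fin 2)) (v : Fin i × Fin 2 → M) (j : Fin i) (x : M),
      (fun j' => e (c j') (Function.update v (j, 0) x (j', 0))
        (Function.update v (j, 0) x (j', 1))) =
      Function.update (fun j' => e (c j') (v (j', 0)) (v (j', 1))) j
        (e (c j) x (v (j, 1))) := by
    intro _ v j x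
    funext j'
    by_cases h : j' = j
    · subst h
      simp
    · simp [h]
  have u1 : ∀ (inst : DecidableEq (Fin i × Fin 2)) (v : Fin i × Fin 2 → M) (j : Fin i) (x : M),
      (fun j' => e (c j') (Function.update v (j, 1) x (j', 0))
        (Function.update v (j, 1) x (j', 1))) =
      Function.update (fun j' => e (c j') (v (j', 0)) (v (j', 1))) j
        (e (c j) (v (j, 0)) x) := by
    intro _ v j x
    funext j'
    by_cases h : j' = j
    · subst h
      simp
    · simp [h]
  { toFun := fun v => exteriorPower.ιMulti ℚ i fun j => e (c j) (v (j, 0)) (v (j, 1))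
    map_update_add' := by
      rintro _ v ⟨j, t⟩ x y
      obtain rfl | rfl : t = 0 ∨ t = 1 := by omega
      · rw [u0, u0, u0, map_add, LinearMap.add_apply, AlternatingMap.map_update_add]
      · rw [u1, u1, u1, map_add, AlternatingMap.map_update_add]
    map_update_smul' := by
      rintro _ v ⟨j, t⟩ r x
      obtain rfl | rfl : t = 0 ∨ t = 1 := by omega
      · rw [u0, u0, map_smul, LinearMap.smul_apply, AlternatingMap.map_update_smul]
      · rw [u1, u1, map_smul, AlternatingMap.map_update_smul] }

theorem wedgeVec_apply (e : C →ₗ[ℚ] M →ₗ[ℚ] M →ₗ[ℚ] V) {i : ℕ} (c : Fin i → C)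
    (v : Fin i × Fin 2 → M) :
    wedgeVec e i c v =
      exteriorPower.ιMulti ℚ i fun j => e (c j) (v (j, 0)) (v (j, 1)) := rfl

/-- The previous map, extended linearly to `M^{⊗ 2i}`, as a multilinear function of the `c_j`. -/
def projMulti (e : C →ₗ[ℚ] M →ₗ[ℚ] M →ₗ[ℚ] V) (i : ℕ) :
    MultilinearMap ℚ (fun _ : Fin i => C) ((⨂[ℚ] _ : Fin i × Fin 2, M) →ₗ[ℚ] ⋀[ℚ]^i V) :=
  have u : ∀ (inst : DecidableEq (Fin i)) (c : Fin i → C) (j : Fin i)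
      (f : C) (v : Fin i × Fin 2 → M),
      (fun j' => e (Function.update c j f j') (v (j', 0)) (v (j', 1))) =
      Function.update (fun j' => e (c j') (v (j', 0)) (v (j', 1))) j
        (e f (v (j, 0)) (v (j, 1))) := by
    intro _ c j f v
    funext j'
    by_cases h : j' = j
    · subst h
      simp
    · simp [h]
  { toFun := fun c => PiTensorProduct.lift (wedgeVec e i c)
    map_update_add' := by
      intro _ c j f f'
      rw [← map_add]
      congr 1
      refine MultilinearMap.ext fun v => ?_
      rw [add_apply, wedgeVec_apply, wedgeVec_apply, wedgeVec_apply, u, u, u,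
        map_add, LinearMap.add_apply, LinearMap.add_apply, AlternatingMap.map_update_add]
    map_update_smul' := by
      intro _ c j r f
      rw [← map_smul]
      congr 1
      refine MultilinearMap.ext fun v => ?_
      rw [smul_apply, wedgeVec_apply, wedgeVec_apply, u, u,
        map_smul, LinearMap.smul_apply, LinearMap.smul_apply, AlternatingMap.map_update_smul] }

/-- The linear map `(⨂_j (a_j ⊗ b_j)) ⊗ (⨂_j c_j) ↦ ⋀_j e(c_j, a_j, b_j)`. -/
def projOf (e : C →ₗ[ℚ] M →ₗ[ℚ] M →ₗ[ℚ] V) (i : ℕ) :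
    (⨂[ℚ] _ : Fin i × Fin 2, M) ⊗[ℚ] (⨂[ℚ] _ : Fin i, C) →ₗ[ℚ] ⋀[ℚ]^i V :=
  TensorProduct.lift (PiTensorProduct.lift (projMulti e i)).flip

theorem projOf_tprod (e : C →ₗ[ℚ] M →ₗ[ℚ] M →ₗ[ℚ] V) (i : ℕ) (v : Fin i × Fin 2 → M)
    (c : Fin i → C) :
    projOf e i (PiTensorProduct.tprod ℚ v ⊗ₜ[ℚ] PiTensorProduct.tprod ℚ c) =
      exteriorPower.ιMulti ℚ i fun j => e (c j) (v (j, 0)) (v (j, 1)) := by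
  rw [projOf, TensorProduct.lift.tmul, LinearMap.flip_apply, PiTensorProduct.lift.tprod]
  exact PiTensorProduct.lift.tprod v

end Projection

/-- `(a ∧ b) ⊗ c^*`, as the element `h ↦ c^*(h) (a ∧ b)` of `U`; it is linear in `c^*`, `a`, `b`. -/
def elemU (n : ℕ) : Module.Dual ℚ (H n) →ₗ[ℚ] H n →ₗ[ℚ] H n →ₗ[ℚ] U n :=
  LinearMap.mk₂ ℚ (fun c a => LinearMap.smulRightₗ c ∘ₗ wedge n a)
    (fun c c' a => by simp only [map_add, LinearMap.add_comp])
    (fun r c a => by simp only [map_smul, LinearMap.smul_comp])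
    (fun c a a' => by simp only [map_add, LinearMap.comp_add])
    (fun c r a => by simp only [map_smul, LinearMap.comp_smul])

theorem elemU_apply {n : ℕ} (c : Module.Dual ℚ (H n)) (a b h : H n) :
    elemU n c a b h = c h • wedge n a b := rfl

/-- The projection `π : H^{⊗ 2i} ⊗ (H^*)^{⊗ i} → ⋀^i U`,
`(⨂_j (a_j ⊗ b_j)) ⊗ (⨂_j c_j^*) ↦ ⋀_j ((a_j ∧ b_j) ⊗ c_j^*)`. The `2i` factors `H` are indexed by
`Fin i × Fin 2`: `a_j` has the index `(j, 0)` and `b_j` the index `(j, 1)`. -/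
def proj (n i : ℕ) :
    (⨂[ℚ] _ : Fin i × Fin 2, H n) ⊗[ℚ] (⨂[ℚ] _ : Fin i, Module.Dual ℚ (H n)) →ₗ[ℚ]
      ⋀[ℚ]^i (U n) :=
  projOf (elemU n) i

/-- The traceless part `H_i(U, ℚ)^tl = π(T_{2i,i})` of `H_i(U, ℚ) = ⋀^i U`. -/
def tracelessPart (n i : ℕ) : Submodule ℚ (⋀[ℚ]^i (U n)) :=
  (traceless (Fin i × Fin 2) (Fin i) n).map (proj n i)

end AlbaneseIA

end

noncomputable section

namespace AlbaneseIA

open CategoryTheory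
open scoped TensorProduct

/-! ### Traceless multilinear forms on mixed tensors -/

section Frames

/-! Abelian cycles supply classes in the Albanese homology. For distinct indices, the `i`
automorphisms `x_c ↦ [x_p, x_q] x_c` commute, since each moves one generator and no word involves a
moved generator. Commuting elements `g_1, …, g_i` of a group carry a class in `H_i`
(`exists_torusClass`) whose image in `⋀^i U` is `τ(g_1) ∧ ⋯ ∧ τ(g_i)`. Conjugating by `ν ∈ Aut(F_n)`
turns the factors into `(b_p ∧ b_q) ⊗ b_c^*`, where `b` is the basis of `H` formed by the classes of
the `ν(x_j)` and `b^*` is its dual basis (`ιMulti_elemU_mem_albaneseIA`).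

It remains to see that the tensors of distinct vectors of such dual frames span `T_{2i,i}`
(`TracelessCoord.mem_span`). They are themselves traceless. The dot product on coordinates is
positive definite over `ℚ`, so a traceless tensor is a sum of one in their span and a traceless one
orthogonal to it. The latter is a multilinear form that vanishes on all tuples of distinct frame
vectors, and must be shown to be zero (`eq_zero_of_vanishesOnDistinct`).

The frames are stable under elementary transvections, which Nielsen transformations realize.
Comparing the form before and after a transvection shows that it also vanishes when two slots of
equal sign share a vector, and gives linear relations among its values on tuples in which two slots
of opposite signs hold dual vectors. Inserted in the trace condition, these relations express `n`
times such a value as a sum, up to sign, of `m - 2` values of the same kind, where `m ≤ n` is the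
number of slots. A value of maximal modulus is therefore zero (`VanishesOnDistinct.match_eq_zero`).
One slot can then be filled arbitrarily, and induction on the number of slots finishes. The bound `n
≥ 3i` is the condition `m ≤ n` for `m = 3i`. -/

theorem frameSlot_update {n : ℕ} {E S : Type} [DecidableEq S] (ε : S → Bool)
    (b : Bool → Fin n → E) (I : S → Fin n) (k : S)
    (x : Fin n) : (fun s => b (ε s) (Function.update I k x s)) =
      Function.update (fun s => b (ε s) (I s)) k (b (ε k) x) := by
  funext s
  by_cases h : s = k
  · subst h
    simp
  · simp [h]

variable {n : ℕ} {E : Type} [AddCommGroup E] [Module ℚ E]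

/-- The pair of frames obtained from `b` by adding `t` times the `y`-th vector of the frame `b e` to
its `x`-th vector, and by changing the other frame contragrediently. -/
def transvect (b : Bool → Fin n → E) (e : Bool) (x y : Fin n) (t : ℚ) : Bool → Fin n → E :=
  fun e' z =>
    if e' = e then (if z = x then b e' x + t • b e' y else b e' z)
    else (if z = y then b e' y + (-t) • b e' x else b e' z)

theorem transvect_apply_left (b : Bool → Fin n → E) (e : Bool) (x y : Fin n) (t : ℚ) :
    transvect b e x y t e x = b e x + t • b e y := by simp [transvect]

theorem transvect_apply_right (b : Bool → Fin n → E) {e e' : Bool} (h : e' ≠ e) (x y : Fin n)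
    (t : ℚ) : transvect b e x y t e' y = b e' y + (-t) • b e' x := by simp [transvect, h]

theorem transvect_apply_of_ne (b : Bool → Fin n → E) {e e' : Bool} {x y z : Fin n} (t : ℚ)
    (h1 : e' = e → z ≠ x) (h2 : e' ≠ e → z ≠ y) : transvect b e x y t e' z = b e' z := by
  unfold transvect
  by_cases h : e' = e
  · rw [if_pos h, if_neg (h1 h)]
  · rw [if_neg h, if_neg (h2 h)]

variable {S : Type} [DecidableEq S]

/-- The value of a multilinear form on a tuple of frame vectors. -/
def frameValue (φ : MultilinearMap ℚ (fun _ : S => E) ℚ) (ε : S → Bool) (b : Bool → Fin n → E)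
    (I : S → Fin n) : ℚ :=
  φ fun s => b (ε s) (I s)

/-- A multilinear form vanishes on all tuples of distinct vectors of the frames in `B`. -/
def VanishesOnDistinct (φ : MultilinearMap ℚ (fun _ : S => E) ℚ) (ε : S → Bool)
    (B : Set (Bool → Fin n → E)) : Prop :=
  ∀ b ∈ B, ∀ I : S → Fin n, Function.Injective I → frameValue φ ε b I = 0

/-- The set `B` of pairs of frames is closed under elementary integral transvections. -/
def TransvectClosed (B : Set (Bool → Fin n → E)) : Prop :=
  ∀ b ∈ B, ∀ (e : Bool) (x y : Fin n), x ≠ y → ∀ t : ℚ, t = 1 ∨ t = -1 → transvect b e x y t ∈ B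

theorem map_update_add_smul (φ : MultilinearMap ℚ (fun _ : S => E) ℚ) (v : S → E)
    (k : S) (x y : E) (t : ℚ) : φ (Function.update v k (x + t • y)) =
      φ (Function.update v k x) + t * φ (Function.update v k y) := by
  rw [φ.map_update_add, φ.map_update_smul, smul_eq_mul]

variable {φ : MultilinearMap ℚ (fun _ : S => E) ℚ} {ε : S → Bool} {B : Set (Bool → Fin n → E)}

/-- Add the vector of `k'` to the vector of `k` by a transvection. The dual vector that changes
along with it has the index `I k'`, which occurs only in a slot of the other sign than needed, so
only slot `k` sees the change. -/
theorem VanishesOnDistinct.of_repeated (h0 : VanishesOnDistinct φ ε B) (hB : TransvectClosed B)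
    {b : Bool → Fin n → E} (hb : b ∈ B) {I : S → Fin n} (hI : Function.Injective I) {k k' : S}
    (hk : k ≠ k') (he : ε k = ε k') : frameValue φ ε b (Function.update I k (I k')) = 0 := by
  have h1 := h0 _ (hB b hb (ε k) (I k) (I k') (hI.ne hk) 1 (Or.inl rfl)) I hI
  have hv : (fun s => transvect b (ε k) (I k) (I k') 1 (ε s) (I s)) =
      Function.update (fun s => b (ε s) (I s)) k
        (b (ε k) (I k) + (1 : ℚ) • b (ε k) (I k')) := by
    funext s
    by_cases h : s = k
    · subst h
      rw [transvect_apply_left]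
      simp
    · rw [Function.update_of_ne h, transvect_apply_of_ne _ _ (fun _ => hI.ne h)]
      intro h2 h3
      rw [hI h3] at h2
      exact h2 he.symm
  have h2 := h0 b hb I hI
  unfold frameValue at h1 h2 ⊢
  rw [hv, map_update_add_smul, Function.update_eq_self, h2] at h1
  rw [frameSlot_update]
  linarith

/-- The transvection replaces `b_k, b_l^*` by `b_k + b_l, b_l^* - b_k^*`. Of the four terms of the
expansion, the original tuple and the tuple with both indices exchanged are distinct, hence vanish;
the two matched terms remain, with opposite signs. -/
theorem VanishesOnDistinct.match_comm (h0 : VanishesOnDistinct φ ε B) (hB : TransvectClosed B)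
    {b : Bool → Fin n → E} (hb : b ∈ B) {I : S → Fin n} (hI : Function.Injective I) {k l : S}
    (he : ε k ≠ ε l) : frameValue φ ε b (Function.update I k (I l)) =
      frameValue φ ε b (Function.update I l (I k)) := by
  have hkl : k ≠ l := fun h => he (by rw [h])
  have h1 := h0 _ (hB b hb (ε k) (I k) (I l) (hI.ne hkl) 1 (Or.inl rfl)) I hI
  have hv : (fun s => transvect b (ε k) (I k) (I l) 1 (ε s) (I s)) =
      Function.update (Function.update (fun s => b (ε s) (I s)) k
        (b (ε k) (I k) + (1 : ℚ) • b (ε k) (I l))) l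
        (b (ε l) (I l) + (-1 : ℚ) • b (ε l) (I k)) := by
    funext s
    by_cases h : s = l
    · subst h
      rw [transvect_apply_right _ he.symm]
      simp
    · rw [Function.update_of_ne h]
      by_cases h' : s = k
      · subst h'
        rw [transvect_apply_left]
        simp
      · rw [Function.update_of_ne h', transvect_apply_of_ne _ _ (fun _ => hI.ne h')
          (fun _ => hI.ne h)]
  have h2 := h0 b hb I hI
  have hs : Function.Injective (Function.update (Function.update I k (I l)) l (I k)) := by
    rw [Function.update_comm hkl]
    have : Function.update (Function.update I l (I k)) k (I l) = I ∘ Equiv.swap k l := by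
      funext s
      by_cases h : s = k
      · subst h; simp
      by_cases h' : s = l
      · subst h'; simp [h]
      simp [h, h', Equiv.swap_apply_of_ne_of_ne]
    rw [this]
    exact hI.comp (Equiv.injective _)
  have h3 := h0 b hb _ hs
  unfold frameValue at h1 h2 h3 ⊢
  have hl : ∀ p, Function.update (Function.update (fun s => b (ε s) (I s)) k p) l
      (b (ε l) (I l)) = Function.update (fun s => b (ε s) (I s)) k p := fun p => by
    rw [Function.update_comm hkl]
    congr 1
    exact Function.update_eq_self _ _
  have hk : ∀ p, Function.update (Function.update (fun s => b (ε s) (I s)) l p) k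
      (b (ε k) (I k)) = Function.update (fun s => b (ε s) (I s)) l p := fun p => by
    rw [Function.update_comm hkl.symm]
    congr 1
    exact Function.update_eq_self _ _
  have hk' : Function.update (fun s => b (ε s) (I s)) k (b (ε k) (I k)) =
    fun s => b (ε s) (I s) := Function.update_eq_self _ _
  rw [hv, map_update_add_smul, hl, Function.update_comm hkl,
    map_update_add_smul, map_update_add_smul, hk, hk', h2] at h1
  rw [frameSlot_update, frameSlot_update, Function.update_comm hkl] at h3
  rw [frameSlot_update, frameSlot_update]
  linarith

/-- This is the linear coefficient in `t` of the expansion of a vanishing value after a transvection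
by `t`. On the left, the three slots `s₀`, `k`, `l` have one common index; on the right, `l` is
matched with `k` and with `s₀` in turn. -/
theorem VanishesOnDistinct.match_add (h0 : VanishesOnDistinct φ ε B) (hB : TransvectClosed B)
    {b : Bool → Fin n → E} (hb : b ∈ B) {I : S → Fin n} (hI : Function.Injective I) {k l s₀ : S}
    (hk : s₀ ≠ k) (hs : ε s₀ = ε k) (he : ε k ≠ ε l) :
    frameValue φ ε b (Function.update (Function.update I k (I s₀)) l (I s₀)) =
      frameValue φ ε b (Function.update I l (I k)) +
        frameValue φ ε b (Function.update (I ∘ Equiv.swap s₀ k) l (I k)) := by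
  have hkl : k ≠ l := fun h => he (by rw [h])
  have hsl : s₀ ≠ l := fun h => he (by rw [← hs, h])
  set v : S → E := fun s => b (ε s) (I s) with hvdef
  let F : E → E → E → ℚ := fun p q r =>
    φ (Function.update (Function.update (Function.update v s₀ p) k q) l r)
  have Fl : ∀ p q r r' (t : ℚ), F p q (r + t • r') = F p q r + t * F p q r' := fun p q r r' t =>
    map_update_add_smul ..
  have Fk : ∀ p q q' r (t : ℚ), F p (q + t • q') r = F p q r + t * F p q' r := by
    intro p q q' r t
    simp only [F, Function.update_comm hkl]
    exact map_update_add_smul ..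
  have Fs : ∀ p p' q r (t : ℚ), F (p + t • p') q r = F p q r + t * F p' q r := by
    intro p p' q r t
    simp only [F, Function.update_comm hk, Function.update_comm hsl]
    exact map_update_add_smul ..
  have hF : ∀ (b' : Bool → Fin n → E) (p q r : Fin n),
      (∀ s, s ≠ s₀ → s ≠ k → s ≠ l → b' (ε s) (I s) = v s) →
      frameValue φ ε b' (Function.update (Function.update (Function.update I s₀ p) k q) l r) =
        F (b' (ε k) p) (b' (ε k) q) (b' (ε l) r) := by
    intro b' p q r h
    simp only [frameValue, frameSlot_update, F, hs]
    congr 1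
    funext s
    by_cases h1 : s = l
    · subst h1; simp
    by_cases h2 : s = k
    · subst h2; simp [h1]
    by_cases h3 : s = s₀
    · subst h3; simp [h1, h2]
    simp [h1, h2, h3, h s h3 h2 h1]
  have hself : Function.update I s₀ (I s₀) = I := Function.update_eq_self _ _
  have hswap : Function.update (Function.update I s₀ (I k)) k (I s₀) = I ∘ Equiv.swap s₀ k := by
    funext s
    by_cases h : s = k
    · subst h; simp
    by_cases h' : s = s₀
    · subst h'; simp [h]
    simp [h, h', Equiv.swap_apply_of_ne_of_ne]
  have hswap' : Function.update (Function.update I k (I l)) l (I k) = I ∘ Equiv.swap k l := by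
    funext s
    by_cases h : s = l
    · subst h; simp
    by_cases h' : s = k
    · subst h'; simp [h]
    simp [h, h', Equiv.swap_apply_of_ne_of_ne]
  -- The value to be expanded: slots `s₀` and `k` repeat a vector and `l` has a different index. It
  -- vanishes for every frame of `B`, in particular after a transvection.
  have hx : ∀ b' ∈ B, frameValue φ ε b'
      (Function.update (Function.update (Function.update I s₀ (I s₀)) k (I s₀)) l (I k)) = 0 := by
    intro b' hb'
    have := h0.of_repeated hB hb' (hI.comp (Equiv.swap k l).injective) hk.symm hs.symm
    rw [← hswap', Function.update_of_ne hsl, Function.update_of_ne hk,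
      Function.update_comm hkl.symm, Function.update_idem] at this
    rwa [hself]
  -- Up to sign, this is the cubic coefficient in `t`.
  have hy : frameValue φ ε b
      (Function.update (Function.update (Function.update I s₀ (I k)) k (I k)) l (I s₀)) = 0 := by
    have hinj : Function.Injective (Function.update (Function.update
        (Function.update I s₀ (I l)) k (I k)) l (I s₀)) := by
      have : Function.update (Function.update (Function.update I s₀ (I l)) k (I k)) l (I s₀) =
          I ∘ Equiv.swap s₀ l := by
        funext s
        by_cases h : s = l
        · subst h; simp
        by_cases h' : s = k
        · subst h'; simp [h, Equiv.swap_apply_of_ne_of_ne, hk.symm]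
        by_cases h'' : s = s₀
        · subst h''; simp [h, h']
        simp [h, h', h'', Equiv.swap_apply_of_ne_of_ne]
      rw [this]
      exact hI.comp (Equiv.injective _)
    have := h0.of_repeated hB hb hinj hk hs
    rwa [Function.update_of_ne hkl, Function.update_self, Function.update_comm hsl.symm,
      Function.update_comm hk.symm, Function.update_idem] at this
  have hexp : ∀ t : ℚ, t = 1 ∨ t = -1 →
      F (b (ε k) (I s₀) + t • b (ε k) (I k)) (b (ε k) (I s₀) + t • b (ε k) (I k))
        (b (ε l) (I k) + (-t) • b (ε l) (I s₀)) = 0 := by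
    intro t ht
    have hb' := hB b hb (ε k) (I s₀) (I k) (hI.ne hk) t ht
    have := hx _ hb'
    rw [hF] at this
    · rwa [transvect_apply_left, transvect_apply_right _ he.symm] at this
    · intro s h1 h2 h3
      exact transvect_apply_of_ne _ _ (fun _ => hI.ne h1) (fun _ => hI.ne h2)
  -- The difference of the values at `t = 1` and `t = -1` removes the quadratic coefficient; the
  -- constant and cubic ones vanish by `hx` and `hy`.
  have e1 := hexp 1 (Or.inl rfl)
  have e2 := hexp (-1) (Or.inr rfl)
  have hx' := hx b hb
  rw [hF _ _ _ _ fun _ _ _ _ => rfl] at hx' hy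
  have g1 := hF b (I s₀) (I s₀) (I s₀) fun _ _ _ _ => rfl
  have g2 := hF b (I s₀) (I k) (I k) fun _ _ _ _ => rfl
  have g3 := hF b (I k) (I s₀) (I k) fun _ _ _ _ => rfl
  rw [hself] at g1 g2
  rw [Function.update_eq_self] at g2
  rw [hswap] at g3
  rw [g1, g2, g3]
  simp only [Fl, Fk, Fs, hx', hy] at e1 e2
  linarith

variable [Fintype S]

/-- The value of the form on frame vectors `I` after the vector of `s₀` has been exchanged with that
of the one of the slots `k`, `l` that has the sign of `s₀`; the slot `s₀` and the other one of `k`, `l`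
are then filled with dual vectors. -/
def swappedMatch (φ : MultilinearMap ℚ (fun _ : S => E) ℚ) (ε : S → Bool) (b : Bool → Fin n → E)
    (I : S → Fin n) (k l s₀ : S) : ℚ :=
  if ε s₀ = ε k then frameValue φ ε b (Function.update (I ∘ Equiv.swap s₀ k) l (I k))
  else frameValue φ ε b (Function.update (I ∘ Equiv.swap s₀ l) k (I l))

/-- The value for a matched pair does not depend on the common index `z` as long as `z` is not used
by a third slot; if a slot `s₀` uses it, `match_add` provides one correction term. Summed over `z`,
this evaluates a contraction. -/
theorem VanishesOnDistinct.match_eq (h0 : VanishesOnDistinct φ ε B) (hB : TransvectClosed B)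
    {b : Bool → Fin n → E} (hb : b ∈ B) {I : S → Fin n} (hI : Function.Injective I) {k l : S}
    (he : ε k ≠ ε l) (z : Fin n) :
    frameValue φ ε b (Function.update (Function.update I k z) l z) =
      frameValue φ ε b (Function.update I l (I k)) +
        ∑ s₀ ∈ {k, l}ᶜ, if I s₀ = z then swappedMatch φ ε b I k l s₀ else 0 := by
  have hkl : k ≠ l := fun h => he (by rw [h])
  by_cases hz : ∃ s, I s = z
  · obtain ⟨s, rfl⟩ := hz
    by_cases hs : s ∈ ({k, l} : Finset S)ᶜ
    · rw [Finset.sum_eq_single s (fun t _ ht => if_neg (hI.ne ht)) (fun h => (h hs).elim),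
        if_pos rfl]
      simp only [Finset.mem_compl, Finset.mem_insert, Finset.mem_singleton, not_or] at hs
      unfold swappedMatch
      split_ifs with hsk
      · exact h0.match_add hB hb hI hs.1 hsk he
      · have hsl : ε s = ε l := by
          cases h1 : ε s <;> cases h2 : ε k <;> cases h3 : ε l <;> simp_all
        rw [← h0.match_comm hB hb hI he, Function.update_comm hkl]
        exact h0.match_add hB hb hI hs.2 hsl he.symm
    · rw [Finset.sum_eq_zero, add_zero]
      · simp only [Finset.mem_compl, Finset.mem_insert, Finset.mem_singleton, not_not] at hs
        rcases hs with rfl | rfl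
        · rw [Function.update_eq_self]
        · rw [Function.update_comm hkl, Function.update_eq_self]
          exact h0.match_comm hB hb hI he
      · intro t ht
        refine if_neg (hI.ne ?_)
        rintro rfl
        exact hs ht
  · rw [Finset.sum_eq_zero fun s _ => if_neg fun h => hz ⟨s, h⟩, add_zero]
    have hinj : Function.Injective (Function.update I l z) := by
      intro s t hst
      by_cases h1 : s = l <;> by_cases h2 : t = l
      · rw [h1, h2]
      · subst h1
        rw [Function.update_self, Function.update_of_ne h2] at hst
        exact (hz ⟨t, hst.symm⟩).elim
      · subst h2
        rw [Function.update_self, Function.update_of_ne h1] at hst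
        exact (hz ⟨s, hst⟩).elim
      · rw [Function.update_of_ne h1, Function.update_of_ne h2] at hst
        exact hI hst
    have := h0.match_comm hB hb hinj he
    rwa [Function.update_self, Function.update_of_ne hkl, Function.update_idem,
      Function.update_comm hkl.symm] at this

/-- All contractions of two slots of opposite signs with a pair of dual frames vanish. -/
def TracelessForm (φ : MultilinearMap ℚ (fun _ : S => E) ℚ) (ε : S → Bool)
    (B : Set (Bool → Fin n → E)) : Prop :=
  ∀ b ∈ B, ∀ k l : S, ε k ≠ ε l → ∀ v : S → E,
    ∑ z, φ (Function.update (Function.update v k (b (ε k) z)) l (b (ε l) z)) = 0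

/-- A maximum principle. For a matched value of largest modulus `M`, the trace condition reads `n`
times the value plus one correction for each of the other `card S - 2` slots. Each correction is
again a matched value, so `n M ≤ (card S - 2) M`, which forces `M = 0`. -/
theorem VanishesOnDistinct.match_eq_zero (h0 : VanishesOnDistinct φ ε B)
    (hB : TransvectClosed B) (ht : TracelessForm φ ε B) (hn : Fintype.card S ≤ n)
    {b : Bool → Fin n → E} (hb : b ∈ B) {I : S → Fin n} (hI : Function.Injective I) {k l : S}
    (he : ε k ≠ ε l) : frameValue φ ε b (Function.update I l (I k)) = 0 := by
  -- The frame is fixed; the maximum runs over all injective index tuples and all pairs of slots of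
  -- opposite signs, so that it also bounds the corrections.
  let X := {p : (S → Fin n) × S × S // Function.Injective p.1 ∧ ε p.2.1 ≠ ε p.2.2}
  let c : X → ℚ := fun p => frameValue φ ε b (Function.update p.1.1 p.1.2.2 (p.1.1 p.1.2.1))
  have : Nonempty X := ⟨⟨(I, k, l), hI, he⟩⟩
  obtain ⟨⟨⟨J, k', l'⟩, hJ, he'⟩, hmax⟩ := Finite.exists_max fun p => |c p|
  set M := |c ⟨(J, k', l'), hJ, he'⟩| with hM
  have hkl : k' ≠ l' := fun h => he' (by rw [h])
  have hsm : ∀ s₀ ∈ ({k', l'} : Finset S)ᶜ, |swappedMatch φ ε b J k' l' s₀| ≤ M := by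
    intro s₀ hs₀
    unfold swappedMatch
    split_ifs with h
    · have := hmax ⟨(J ∘ Equiv.swap s₀ k', s₀, l'), hJ.comp (Equiv.injective _), by
        show ε s₀ ≠ ε l'
        rwa [h]⟩
      simpa [c] using this
    · have := hmax ⟨(J ∘ Equiv.swap s₀ l', s₀, k'), hJ.comp (Equiv.injective _), h⟩
      simpa [c] using this
  have htr := ht b hb k' l' he' fun s => b (ε s) (J s)
  have hsum : (n : ℚ) * c ⟨(J, k', l'), hJ, he'⟩ +
      ∑ s₀ ∈ {k', l'}ᶜ, swappedMatch φ ε b J k' l' s₀ = 0 := by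
    rw [← htr]
    have : ∀ z, φ (Function.update (Function.update (fun s => b (ε s) (J s)) k' (b (ε k') z)) l'
        (b (ε l') z)) = c ⟨(J, k', l'), hJ, he'⟩ +
        ∑ s₀ ∈ {k', l'}ᶜ, if J s₀ = z then swappedMatch φ ε b J k' l' s₀ else 0 := by
      intro z
      rw [← h0.match_eq hB hb hJ he' z, frameValue, frameSlot_update, frameSlot_update]
    simp only [this, Finset.sum_add_distrib, Finset.sum_const, Finset.card_univ,
      Fintype.card_fin, nsmul_eq_mul]
    rw [Finset.sum_comm]
    simp
  have hle : (n : ℚ) * M ≤ (({k', l'} : Finset S)ᶜ.card : ℚ) * M := by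
    calc (n : ℚ) * M = |∑ s₀ ∈ {k', l'}ᶜ, swappedMatch φ ε b J k' l' s₀| := by
          rw [← abs_neg, ← eq_neg_of_add_eq_zero_left hsum, abs_mul, Nat.abs_cast]
      _ ≤ ∑ s₀ ∈ {k', l'}ᶜ, |swappedMatch φ ε b J k' l' s₀| := Finset.abs_sum_le_sum_abs _ _
      _ ≤ _ := by
          rw [← nsmul_eq_mul]
          exact Finset.sum_le_card_nsmul _ _ _ hsm
  have hcard : ({k', l'} : Finset S)ᶜ.card < n := by
    have h2 : ({k', l'} : Finset S).card = 2 := Finset.card_pair hkl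
    have h3 := Finset.card_compl_add_card ({k', l'} : Finset S)
    omega
  have hM0 : M ≤ 0 := by
    have : (({k', l'} : Finset S)ᶜ.card : ℚ) < n := by exact_mod_cast hcard
    by_contra! h
    nlinarith
  exact abs_nonpos_iff.1 ((hmax ⟨(I, k, l), hI, he⟩).trans hM0)

/-- A traceless multilinear form on at most `n` slots that vanishes on all tuples of distinct frame
vectors is zero. -/
theorem eq_zero_of_vanishesOnDistinct {B : Set (Bool → Fin n → E)} (hB : TransvectClosed B)
    (hspan : ∀ b ∈ B, ∀ e, Submodule.span ℚ (Set.range (b e)) = ⊤) (hne : B.Nonempty) :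
    ∀ (m : ℕ) (_ : m ≤ n) (ε : Fin m → Bool) (φ : MultilinearMap ℚ (fun _ : Fin m => E) ℚ),
      VanishesOnDistinct φ ε B → TracelessForm φ ε B → φ = 0 := by
  intro m
  induction m with
  | zero =>
    intro _ ε φ h0 _
    obtain ⟨b, hb⟩ := hne
    ext v
    have := h0 b hb Fin.elim0 fun i => i.elim0
    rw [frameValue] at this
    rw [zero_apply, ← this]
    congr 1
    exact Subsingleton.elim _ _
  | succ m ih =>
    intro hm ε φ h0 ht
    -- Fixing the vector of slot `0` keeps the form traceless. It keeps the vanishing on distinct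
    -- vectors as well, because by linearity `x` may be taken from the frame, where an index can
    -- coincide with at most one of the others.
    have key : ∀ x : E, φ.curryLeft x = 0 := by
      intro x
      refine ih (by omega) (fun s => ε s.succ) _ ?_ ?_
      · intro b hb I hI
        have hx : x ∈ Submodule.span ℚ (Set.range (b (ε 0))) := by
          rw [hspan b hb]
          trivial
        -- An unused index exists since `m + 1 ≤ n`; it gives the injective tuple to which the two
        -- exchange lemmas apply.
        obtain ⟨y, hy⟩ : ∃ y, y ∉ Set.range I := by
          by_contra! h
          have := Fintype.card_le_of_surjective I h
          simp at this
          omega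
        have hI' : ∀ z, z ∉ Set.range I →
            Function.Injective (Fin.cons z I : Fin (m + 1) → Fin n) := fun z hz =>
          Fin.cons_injective_iff.2 ⟨hz, hI⟩
        have hz : ∀ z, frameValue φ ε b (Fin.cons z I) = 0 := by
          intro z
          by_cases h : z ∈ Set.range I
          · obtain ⟨s, rfl⟩ := h
            by_cases hs : ε s.succ = ε 0
            · have := h0.of_repeated hB hb (hI' y hy) (Fin.succ_ne_zero s).symm hs.symm
              simpa [Fin.update_cons_zero] using this
            · have := h0.match_eq_zero hB ht (by simpa using hm) hb (hI' y hy) hs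
              simpa [Fin.update_cons_zero] using this
          · exact h0 b hb _ (hI' z h)
        rw [frameValue]
        induction hx using Submodule.span_induction with
        | mem x hx =>
          obtain ⟨z, rfl⟩ := hx
          rw [← hz z, frameValue, MultilinearMap.curryLeft_apply]
          congr 1
          funext s
          refine Fin.cases ?_ (fun s => ?_) s <;> simp
        | zero => simp
        | add x y _ _ hx hy => rw [map_add, add_apply, hx, hy, add_zero]
        | smul r x _ hx => rw [map_smul, smul_apply, hx, smul_zero]
      · intro b hb k l hkl v
        have := ht b hb k.succ l.succ hkl (Fin.cons x v)
        simpa [Fin.cons_update] using this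
    ext v
    have := congrArg (fun f => f fun s => v s.succ) (key (v 0))
    rw [MultilinearMap.curryLeft_apply] at this
    rw [← Fin.cons_self_tail v]
    exact this

end Frames

/-! ### Traceless tensors are spanned by tensors of dual frames -/

section FrameTensor

variable {n m : ℕ}

/-- The coordinates of the tensor product of the frame vectors `I`. -/
def frameTensor {S : Type} [Fintype S] (ε : S → Bool) (b : Bool → Fin n → Fin n → ℚ)
    (I : S → Fin n) : (S → Fin n) → ℚ :=
  fun J => ∏ s, b (ε s) (I s) (J s)

/-- The two frames are dual to each other. -/
def DualFrames (b : Bool → Fin n → Fin n → ℚ) : Prop :=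
  Matrix.of (b false) * (Matrix.of (b true)).transpose = 1

theorem DualFrames.sum_coord {b : Bool → Fin n → Fin n → ℚ} (hb : DualFrames b) {e e' : Bool}
    (he : e ≠ e') (i j : Fin n) : ∑ x, b e i x * b e' j x = if i = j then 1 else 0 := by
  have h : ∀ i j, ∑ x, b false i x * b true j x = if i = j then 1 else 0 := by
    intro i j
    have := congrFun (congrFun hb i) j
    simpa [Matrix.mul_apply, Matrix.one_apply] using this
  cases e <;> cases e'
  · exact (he rfl).elim
  · exact h i j
  · rw [← Finset.sum_congr rfl fun x _ => mul_comm (b false j x) _, h]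
    simp only [eq_comm]
  · exact (he rfl).elim

theorem DualFrames.sum_frame {b : Bool → Fin n → Fin n → ℚ} (hb : DualFrames b) {e e' : Bool}
    (he : e ≠ e') (x y : Fin n) : ∑ i, b e i x * b e' i y = if x = y then 1 else 0 := by
  have h : ∀ x y, ∑ i, b false i x * b true i y = if x = y then 1 else 0 := by
    intro x y
    have hb' : Matrix.of (b false) * (Matrix.of (b true)).transpose = 1 := hb
    have hb'' := mul_eq_one_comm.1 hb'
    have := congrFun (congrFun hb'' y) x
    simp only [Matrix.mul_apply, Matrix.one_apply, Matrix.transpose_apply, Matrix.of_apply] at this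
    rw [← Finset.sum_congr rfl fun i _ => mul_comm (b true i y) _, this]
    simp only [eq_comm]
  cases e <;> cases e'
  · exact (he rfl).elim
  · exact h x y
  · rw [← Finset.sum_congr rfl fun i _ => mul_comm (b false i y) _, h]
    simp only [eq_comm]
  · exact (he rfl).elim

theorem DualFrames.span_eq_top {b : Bool → Fin n → Fin n → ℚ} (hb : DualFrames b) (e : Bool) :
    Submodule.span ℚ (Set.range (b e)) = ⊤ := by
  rw [eq_top_iff]
  intro v _
  have : v = ∑ i, (∑ y, b (!e) i y * v y) • b e i := by
    funext x
    simp only [Finset.sum_apply, Pi.smul_apply, smul_eq_mul, Finset.sum_mul]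
    rw [Finset.sum_comm]
    have : ∀ y, ∑ i, b (!e) i y * v y * b e i x = v y * if y = x then 1 else 0 := by
      intro y
      rw [← hb.sum_frame (e := !e) (e' := e) (by simp), Finset.mul_sum]
      exact Finset.sum_congr rfl fun i _ => by ring
    simp [this]
  rw [this]
  exact Submodule.sum_mem _ fun i _ => Submodule.smul_mem _ _ (Submodule.subset_span ⟨i, rfl⟩)

variable {S : Type} [Fintype S] [DecidableEq S]

/-- All contractions of two indices of opposite signs vanish. -/
def TracelessCoord (ε : S → Bool) (y : (S → Fin n) → ℚ) : Prop :=
  ∀ k l : S, ε k ≠ ε l → ∀ J : S → Fin n,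
    ∑ x, y (Function.update (Function.update J k x) l x) = 0

theorem prod_update_pair {α : Type} (f : S → α → ℚ) {k l : S} (hkl : k ≠ l) (J : S → α)
    (x : α) : ∏ s, f s (Function.update (Function.update J k x) l x s) =
      f k x * f l x * ∏ s ∈ {k, l}ᶜ, f s (J s) := by
  rw [← Finset.prod_mul_prod_compl {k, l}, Finset.prod_pair hkl]
  congr 1
  · simp [hkl]
  · refine Finset.prod_congr rfl fun s hs => ?_
    simp only [Finset.mem_compl, Finset.mem_insert, Finset.mem_singleton, not_or] at hs
    simp [hs.1, hs.2]

/-- Contracting two slots pairs a frame vector with a dual frame vector of another index, which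
gives zero. -/
theorem tracelessCoord_frameTensor {b : Bool → Fin n → Fin n → ℚ} (hb : DualFrames b)
    (ε : S → Bool) {I : S → Fin n} (hI : Function.Injective I) :
    TracelessCoord ε (frameTensor ε b I) := by
  intro k l he J
  have hkl : k ≠ l := fun h => he (by rw [h])
  simp only [frameTensor]
  rw [Finset.sum_congr rfl fun x _ => prod_update_pair (fun s => b (ε s) (I s)) hkl J x,
    ← Finset.sum_mul, hb.sum_coord he, if_neg (hI.ne hkl), zero_mul]

/-- A tuple with equal entries at `k` and `l` amounts to its other entries together with the common
entry; the arbitrary value `c` only serves to normalize the former. -/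
theorem sum_diagonal_eq (k l : S) (hkl : k ≠ l) (c : Fin n) (G : (S → Fin n) → ℚ) :
    ∑ J, (if J k = J l then G J else 0) = ∑ J ∈ Finset.univ.filter fun J => J k = c ∧ J l = c,
      ∑ x, G (Function.update (Function.update J k x) l x) := by
  rw [← Finset.sum_filter, ← Finset.sum_product']
  refine Finset.sum_nbij' (fun J => (Function.update (Function.update J k c) l c, J k))
    (fun p => Function.update (Function.update p.1 k p.2) l p.2) ?_ ?_ ?_ ?_ ?_
  · intro J _
    simp [hkl]
  · intro p _
    simp [hkl]
  · intro J hJ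
    have hJ : J k = J l := by simpa using hJ
    funext s
    by_cases h : s = l
    · subst h; simp [hJ]
    by_cases h' : s = k
    · subst h'; simp [h]
    simp [h, h']
  · rintro ⟨J, x⟩ hJ
    have hJ : J k = c ∧ J l = c := by simpa using hJ
    refine Prod.ext ?_ ?_
    · funext s
      by_cases h : s = l
      · subst h; simp [hJ.2]
      by_cases h' : s = k
      · subst h'; simp [h, hJ.1]
      simp [h, h']
    · simp [hkl]
  · intro J hJ
    have hJ : J k = J l := by simpa using hJ
    congr 1
    funext s
    by_cases h : s = l
    · subst h; simp [hJ]
    by_cases h' : s = k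
    · subst h'; simp [h]
    simp [h, h']

/-- The multilinear form with the given coefficients. -/
def coordForm (y : (S → Fin n) → ℚ) : MultilinearMap ℚ (fun _ : S => Fin n → ℚ) ℚ :=
  ∑ J, y J • (MultilinearMap.mkPiAlgebra ℚ S ℚ).compLinearMap fun s => LinearMap.proj (J s)

theorem coordForm_apply (y : (S → Fin n) → ℚ) (v : S → Fin n → ℚ) :
    coordForm y v = ∑ J, y J * ∏ s, v s (J s) := by
  simp [coordForm]

theorem coordForm_single (y : (S → Fin n) → ℚ) (J : S → Fin n) :
    coordForm y (fun s => Pi.single (J s) 1) = y J := by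
  rw [coordForm_apply, Finset.sum_eq_single J]
  · simp
  · intro J' _ h
    obtain ⟨s, hs⟩ := Function.ne_iff.1 h
    rw [Finset.prod_eq_zero (Finset.mem_univ s) (by simp [hs]), mul_zero]
  · simp

/-- The element `∑ z, b_z ⊗ b_z^*` is the same for all pairs of dual frames, so contraction with any
of them is contraction in the standard coordinates. -/
theorem TracelessCoord.tracelessForm {ε : S → Bool} {y : (S → Fin n) → ℚ}
    (hy : TracelessCoord ε y) {B : Set (Bool → Fin n → Fin n → ℚ)}
    (hd : ∀ b ∈ B, DualFrames b) : TracelessForm (coordForm y) ε B := by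
  intro b hb k l he v
  have hkl : k ≠ l := fun h => he (by rw [h])
  rcases isEmpty_or_nonempty (Fin n) with _ | ⟨⟨c⟩⟩
  · simp
  simp only [coordForm_apply]
  rw [Finset.sum_comm]
  let w : (S → Fin n) → ℚ := fun J => ∏ s ∈ {k, l}ᶜ, v s (J s)
  have h1 : ∀ J : S → Fin n, ∑ z, y J * ∏ s, Function.update
      (Function.update v k (b (ε k) z)) l (b (ε l) z) s (J s) =
      if J k = J l then y J * w J else 0 := by
    intro J
    have h2 : ∀ z, y J * ∏ s, Function.update
        (Function.update v k (b (ε k) z)) l (b (ε l) z) s (J s) =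
        y J * w J * (b (ε k) z (J k) * b (ε l) z (J l)) := by
      intro z
      rw [← Finset.prod_mul_prod_compl {k, l}, Finset.prod_pair hkl]
      have : ∏ s ∈ {k, l}ᶜ, Function.update
          (Function.update v k (b (ε k) z)) l (b (ε l) z) s (J s) = w J := by
        refine Finset.prod_congr rfl fun s hs => ?_
        simp only [Finset.mem_compl, Finset.mem_insert, Finset.mem_singleton, not_or] at hs
        simp [hs.1, hs.2]
      rw [this]
      simp only [Function.update_self, Function.update_of_ne hkl]
      ring
    rw [Finset.sum_congr rfl fun z _ => h2 z, ← Finset.mul_sum, (hd b hb).sum_frame he]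
    simp
  rw [Finset.sum_congr rfl fun J _ => h1 J, sum_diagonal_eq k l hkl c]
  refine Finset.sum_eq_zero fun J _ => ?_
  have h3 : ∀ x, w (Function.update (Function.update J k x) l x) = w J := by
    intro x
    refine Finset.prod_congr rfl fun s hs => ?_
    simp only [Finset.mem_compl, Finset.mem_insert, Finset.mem_singleton, not_or] at hs
    simp [hs.1, hs.2]
  simp only [h3]
  rw [← Finset.sum_mul, hy k l he J, zero_mul]

/-- Traceless tensors of at most `n` factors are spanned by the tensors of distinct frame
vectors. -/
theorem TracelessCoord.mem_span {B : Set (Bool → Fin n → Fin n → ℚ)} (hB : TransvectClosed B)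
    (hd : ∀ b ∈ B, DualFrames b) (hne : B.Nonempty) (hm : m ≤ n) {ε : Fin m → Bool}
    {y : (Fin m → Fin n) → ℚ} (hy : TracelessCoord ε y) :
    y ∈ Submodule.span ℚ
      {w | ∃ b ∈ B, ∃ I : Fin m → Fin n, Function.Injective I ∧ w = frameTensor ε b I} := by
  set O := Submodule.span ℚ
    {w | ∃ b ∈ B, ∃ I : Fin m → Fin n, Function.Injective I ∧ w = frameTensor ε b I} with hO
  let β : LinearMap.BilinForm ℚ ((Fin m → Fin n) → ℚ) := dotProductBilin ℚ ℚ
  have hβ : ∀ u v, β u v = u ⬝ᵥ v := fun _ _ => rfl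
  have hrefl : β.IsRefl := by
    intro u v h
    rw [hβ] at h ⊢
    rwa [dotProduct_comm]
  -- The dot product over `ℚ` is positive definite, so every subspace has an orthogonal complement.
  have hnd : (β.restrict O).Nondegenerate := by
    refine (LinearMap.IsRefl.nondegenerate_iff_separatingLeft ?_).2 ?_
    · intro u v h
      exact hrefl _ _ h
    · intro u hu
      have := hu u
      rw [LinearMap.BilinForm.restrict_apply] at this
      simpa using dotProduct_self_eq_zero.1 this
  have hc := LinearMap.BilinForm.isCompl_orthogonal_of_restrict_nondegenerate hrefl hnd
  obtain ⟨o, ho, p, hp, rfl⟩ := Submodule.mem_sup.1 (hc.sup_eq_top ▸ Submodule.mem_top (x := y))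
  have hoT : TracelessCoord ε o := by
    clear hy
    induction ho using Submodule.span_induction with
    | mem x hx =>
      obtain ⟨b, hb, I, hI, rfl⟩ := hx
      exact tracelessCoord_frameTensor (hd b hb) ε hI
    | zero => intro k l _ J; simp
    | add x y _ _ hx hy =>
      intro k l he J
      simp [Finset.sum_add_distrib, hx k l he J, hy k l he J]
    | smul r x _ hx =>
      intro k l he J
      simp [← Finset.mul_sum, hx k l he J]
  have hpT : TracelessCoord ε p := by
    intro k l he J
    have := hy k l he J
    simpa [Finset.sum_add_distrib, hoT k l he J] using this
  have hφ : coordForm p = 0 := by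
    refine eq_zero_of_vanishesOnDistinct hB (fun b hb => (hd b hb).span_eq_top) hne m hm ε _ ?_
      (hpT.tracelessForm hd)
    intro b hb I hI
    have : frameTensor ε b I ⬝ᵥ p = 0 := hp _ (Submodule.subset_span ⟨b, hb, I, hI, rfl⟩)
    rw [frameValue, coordForm_apply]
    rw [← this]
    exact Finset.sum_congr rfl fun J _ => mul_comm _ _
  have hp0 : p = 0 := by
    funext J
    rw [← coordForm_single p J, hφ]
    rfl
  rwa [hp0, add_zero]

end FrameTensor

/-! ### The homology class of a tuple of commuting elements -/

section Torus

variable {G : Type} [Group G]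

/-- The chain `∑_σ sgn(σ) [g_σ(1) | ⋯ | g_σ(i)]`. -/
def torusChain {i : ℕ} (g : Fin i → G) : (Fin i → G) →₀ ℚ :=
  ∑ σ : Equiv.Perm (Fin i), Finsupp.single (fun k => g (σ k)) ((Equiv.Perm.sign σ : ℤ) : ℚ)

theorem sum_sign_single_eq_neg {i : ℕ} {X : Type} (τ : Equiv.Perm (Fin i))
    (F : Equiv.Perm (Fin i) → X) :
    ∑ σ, Finsupp.single (F σ) ((Equiv.Perm.sign σ : ℤ) : ℚ) =
      ((Equiv.Perm.sign τ : ℤ) : ℚ) •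
        ∑ σ, Finsupp.single (F (σ * τ)) ((Equiv.Perm.sign σ : ℤ) : ℚ) := by
  rw [← Equiv.sum_comp (Equiv.mulRight τ), Finset.smul_sum]
  refine Finset.sum_congr rfl fun σ _ => ?_
  simp [Finsupp.smul_single, mul_comm]

/-- The inner faces cancel in pairs under adjacent transpositions, because the elements commute; the
two outer faces cancel under the cyclic rotation, whose sign is `(-1) ^ m`. -/
theorem d_torusChain {m : ℕ} (g : Fin (m + 1) → G) (hg : ∀ j k, g j * g k = g k * g j)
    (d : ((Fin (m + 1) → G) →₀ ℚ) →ₗ[ℚ] ((Fin m → G) →₀ ℚ))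
    (hd : ∀ (x : Fin (m + 1) → G) (r : ℚ), d (Finsupp.single x r) =
      Finsupp.single (fun k => x k.succ) r + ∑ j : Fin (m + 1), (-1 : ℚ) ^ ((j : ℕ) + 1) •
        Finsupp.single (Fin.contractNth j (· * ·) x) r) : d (torusChain g) = 0 := by
  have hmid : ∀ j : Fin m, ∑ σ : Equiv.Perm (Fin (m + 1)), Finsupp.single
      (Fin.contractNth j.castSucc (· * ·) fun k => g (σ k))
        ((Equiv.Perm.sign σ : ℤ) : ℚ) = 0 := by
    intro j
    have h1 := sum_sign_single_eq_neg (Equiv.swap j.castSucc j.succ)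
      fun σ => Fin.contractNth j.castSucc (· * ·) fun k => g (σ k)
    have h2 : ∀ σ : Equiv.Perm (Fin (m + 1)),
        (Fin.contractNth j.castSucc (· * ·) fun k =>
          g ((σ * Equiv.swap j.castSucc j.succ) k)) =
        Fin.contractNth j.castSucc (· * ·) fun k => g (σ k) := by
      intro σ
      funext k
      rcases lt_trichotomy k j with h | h | h
      · rw [Fin.contractNth_apply_of_lt _ _ _ _ (by simpa using h),
          Fin.contractNth_apply_of_lt _ _ _ _ (by simpa using h), Equiv.Perm.mul_apply,
          Equiv.swap_apply_of_ne_of_ne]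
        · simpa using h.ne
        · rw [Fin.lt_def] at h
          rw [Ne, Fin.ext_iff]
          simp
          omega
      · subst h
        rw [Fin.contractNth_apply_of_eq _ _ _ _ (by simp),
          Fin.contractNth_apply_of_eq _ _ _ _ (by simp)]
        simp only [Equiv.Perm.mul_apply, Equiv.swap_apply_left, Equiv.swap_apply_right]
        exact hg _ _
      · rw [Fin.contractNth_apply_of_gt _ _ _ _ (by simpa using h),
          Fin.contractNth_apply_of_gt _ _ _ _ (by simpa using h), Equiv.Perm.mul_apply,
          Equiv.swap_apply_of_ne_of_ne]
        · rw [Fin.lt_def] at h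
          rw [Ne, Fin.ext_iff]
          simp
          omega
        · simpa using h.ne'
    simp only [h2] at h1
    -- The sum now equals its own negative.
    rw [Equiv.Perm.sign_swap (Fin.castSucc_lt_succ (i := j)).ne] at h1
    simpa [self_eq_neg] using h1
  have hlast : ∑ σ : Equiv.Perm (Fin (m + 1)), Finsupp.single
      (fun k : Fin m => g (σ k.succ)) ((Equiv.Perm.sign σ : ℤ) : ℚ) +
      (-1 : ℚ) ^ (m + 1) • ∑ σ : Equiv.Perm (Fin (m + 1)), Finsupp.single
      (Fin.contractNth (Fin.last m) (· * ·) fun k => g (σ k))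
        ((Equiv.Perm.sign σ : ℤ) : ℚ) = 0 := by
    rw [sum_sign_single_eq_neg (finRotate (m + 1))
      fun σ => Fin.contractNth (Fin.last m) (· * ·) fun k => g (σ k)]
    have h2 : ∀ σ : Equiv.Perm (Fin (m + 1)),
        (Fin.contractNth (Fin.last m) (· * ·) fun k => g ((σ * finRotate (m + 1)) k)) =
        fun k : Fin m => g (σ k.succ) := by
      intro σ
      funext k
      rw [Fin.contractNth_apply_of_lt _ _ _ _ (by simp), Equiv.Perm.mul_apply]
      congr 2
      ext
      rw [coe_finRotate_of_ne_last (Fin.castSucc_lt_last k).ne]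
      simp
    simp only [h2, sign_finRotate]
    rw [smul_smul]
    push_cast
    rw [pow_succ, mul_right_comm, ← mul_pow]
    simp
  rw [torusChain, map_sum]
  simp only [hd]
  rw [Finset.sum_add_distrib, Finset.sum_comm, Fin.sum_univ_castSucc]
  simp only [← Finset.smul_sum, hmid, smul_zero, Finset.sum_const_zero, zero_add, Fin.val_last]
  exact hlast

theorem rationalHomologyMap_comp {G' G'' : Type} [Group G'] [Group G''] (f : G →* G')
    (f' : G' →* G'') (i : ℕ) : rationalHomologyMap (f'.comp f) i =
      rationalHomologyMap f' i ∘ₗ rationalHomologyMap f i := by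
  have := groupHomology.map_comp (A := Rep.trivial ℚ G ℚ) (B := Rep.trivial ℚ G' ℚ)
    (C := Rep.trivial ℚ G'' ℚ) f f' (Rep.ofHom ⟨LinearMap.id, fun _ => rfl⟩)
    (Rep.ofHom ⟨LinearMap.id, fun _ => rfl⟩) i
  exact congrArg ModuleCat.Hom.hom this

/-- All `i!` permutations contribute the same term, which the factor `1 / i!` compensates. -/
theorem chainsToExterior_torusChain {V : Type} [AddCommGroup V] [Module ℚ V] {i : ℕ}
    (f : G →* Multiplicative V) (g : Fin i → G) :
    chainsToExterior V i (torusChain fun k => f (g k)) =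
      exteriorPower.ιMulti ℚ i fun k => (f (g k)).toAdd := by
  have h : ∀ σ : Equiv.Perm (Fin i), chainsToExterior V i
      (Finsupp.single (fun k => f (g (σ k))) ((Equiv.Perm.sign σ : ℤ) : ℚ)) =
      ((i.factorial : ℚ)⁻¹) • exteriorPower.ιMulti ℚ i fun k => (f (g k)).toAdd := by
    intro σ
    rw [chainsToExterior, Finsupp.linearCombination_single,
      smul_comm,
      show (fun j => (f (g (σ j))).toAdd) = (fun k => (f (g k)).toAdd) ∘ σ from rfl,
      AlternatingMap.map_perm]
    congr 1
    rw [Units.smul_def, ← Int.cast_smul_eq_zsmul ℚ, smul_smul, ← Int.cast_mul,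
      ← Units.val_mul, Int.units_mul_self]
    simp
  rw [torusChain, map_sum, Finset.sum_congr rfl fun σ _ => h σ, Finset.sum_const,
    Finset.card_univ, Fintype.card_perm, Fintype.card_fin, ← Nat.cast_smul_eq_nsmul ℚ, smul_smul,
    mul_inv_cancel₀ (by exact_mod_cast i.factorial_ne_zero), one_smul]

/-- A cycle `c` of a chain complex has a homology class, and the map on homology induced by a chain
map followed by a linear map `e` that vanishes on boundaries can be computed on `c`. -/
theorem exists_homologyClass (C : ChainComplex (ModuleCat.{0} ℚ) ℕ) (i : ℕ) (c : C.X i)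
    (hc : (C.d i ((ComplexShape.down ℕ).next i)).hom c = 0) :
    ∃ z : C.homology i, ∀ (D : ChainComplex (ModuleCat.{0} ℚ) ℕ) (F : C ⟶ D) (A : ModuleCat.{0} ℚ)
      (e : D.X i ⟶ A) (he : D.d (i + 1) i ≫ e = 0),
      (D.homologyι i ≫ D.descOpcycles e (i + 1) (by simp) he).hom
        ((HomologicalComplex.homologyMap F i).hom z) = e.hom ((F.f i).hom c) := by
  let κ : ModuleCat.of ℚ ℚ ⟶ C.X i := ModuleCat.ofHom (LinearMap.toSpanSingleton ℚ (C.X i) c)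
  have hκ : κ ≫ C.d i ((ComplexShape.down ℕ).next i) = 0 :=
    ModuleCat.hom_ext (LinearMap.ext_ring (by simpa [κ] using hc))
  refine ⟨(C.liftCycles κ _ rfl hκ ≫ C.homologyπ i).hom 1, fun D F A e he => ?_⟩
  have key : (C.liftCycles κ _ rfl hκ ≫ C.homologyπ i) ≫ HomologicalComplex.homologyMap F i ≫
        D.homologyι i ≫ D.descOpcycles e (i + 1) (by simp) he = κ ≫ F.f i ≫ e := by
    simp
  refine (congrArg (fun q => q.hom (1 : ℚ)) key).trans ?_
  simp [κ]

theorem chainsMap_torusChain {G' : Type} [Group G'] (f : G →* G') {i : ℕ} (g : Fin i → G) :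
    ((groupHomology.chainsMap (A := Rep.trivial ℚ G ℚ) (B := Rep.trivial ℚ G' ℚ) f
      (Rep.ofHom ⟨LinearMap.id, fun _ => rfl⟩)).f i).hom (torusChain g) =
      torusChain fun k => f (g k) := by
  rw [torusChain, torusChain]
  refine (map_sum (ModuleCat.Hom.hom _) _ _).trans ?_
  exact Finset.sum_congr rfl fun σ _ => groupHomology.chainsMap_f_single _ _ i _ _

theorem d_next_torusChain {i : ℕ} (g : Fin i → G) (hg : ∀ j k, g j * g k = g k * g j) :
    ((groupHomology.inhomogeneousChains (Rep.trivial ℚ G ℚ)).d i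
      ((ComplexShape.down ℕ).next i)).hom (torusChain g) = 0 := by
  cases i with
  | zero =>
    -- In degree `0` there is no next degree, and the differential is zero by convention.
    rw [HomologicalComplex.shape _ _ _ (by simp)]
    rfl
  | succ m =>
    rw [ChainComplex.next_nat_succ, groupHomology.inhomogeneousChains.d_def]
    exact d_torusChain g hg (groupHomology.inhomogeneousChains.d (Rep.trivial ℚ G ℚ) m).hom
      fun x r => by simp [groupHomology.inhomogeneousChains.d]

/-- Commuting elements `g_1, …, g_i` of `G` determine a class in `H_i(G, ℚ)` whose image under any
homomorphism `f` to a rational vector space is `f(g_1) ∧ ⋯ ∧ f(g_i)`. -/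
theorem exists_torusClass {i : ℕ} (g : Fin i → G) (hg : ∀ j k, g j * g k = g k * g j) :
    ∃ z : rationalHomology G i, ∀ (V : Type) [AddCommGroup V] [Module ℚ V]
      (f : G →* Multiplicative V), homologyToExterior V i (rationalHomologyMap f i z) =
        exteriorPower.ιMulti ℚ i fun k => (f (g k)).toAdd := by
  obtain ⟨z, hz⟩ := exists_homologyClass (groupHomology.inhomogeneousChains (Rep.trivial ℚ G ℚ)) i
    (torusChain g) (d_next_torusChain g hg)
  refine ⟨z, fun V _ _ f => ?_⟩
  rw [← chainsToExterior_torusChain, ← chainsMap_torusChain]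
  exact hz _ _ _ _ _

end Torus

/-! ### Frames of automorphisms of the free group and abelian cycles -/

section Automorphisms

variable {n : ℕ}

/-- The endomorphism of the free group with `x_c ↦ w x_c` that fixes the other generators. -/
def leftMulHom (c : Fin n) (w : FreeGroup (Fin n)) : FreeGroup (Fin n) →* FreeGroup (Fin n) :=
  FreeGroup.lift fun j => if j = c then w * FreeGroup.of j else FreeGroup.of j

theorem leftMulHom_of (c : Fin n) (w : FreeGroup (Fin n)) (j : Fin n) :
    leftMulHom c w (FreeGroup.of j) = if j = c then w * FreeGroup.of j else FreeGroup.of j := by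
  simp [leftMulHom]

theorem leftMulHom_comp (c : Fin n) {w u : FreeGroup (Fin n)} (h : leftMulHom c u w = w) :
    (leftMulHom c u).comp (leftMulHom c w) = leftMulHom c (w * u) := by
  ext j : 1
  by_cases hj : j = c <;> simp [leftMulHom_of, hj, h, mul_assoc]

theorem leftMulHom_one (c : Fin n) : leftMulHom c 1 = MonoidHom.id _ := by
  ext j : 1
  simp [leftMulHom_of]

/-- The automorphism of the free group with `x_c ↦ w x_c` that fixes the other generators, for a
word `w` that does not involve `x_c`. -/
def leftMulAut (c : Fin n) (w : FreeGroup (Fin n)) (h : ∀ u, leftMulHom c u w = w) :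
    MulAut (FreeGroup (Fin n)) :=
  MonoidHom.toMulEquiv (leftMulHom c w) (leftMulHom c w⁻¹)
    (by rw [leftMulHom_comp c (h _), mul_inv_cancel, leftMulHom_one])
    (by rw [leftMulHom_comp c (by rw [map_inv, h]), inv_mul_cancel, leftMulHom_one])

theorem leftMulAut_apply (c : Fin n) (w : FreeGroup (Fin n)) (h : ∀ u, leftMulHom c u w = w)
    (x : FreeGroup (Fin n)) : leftMulAut c w h x = leftMulHom c w x := rfl

/-- Each automorphism moves only its own generator and fixes the word of the other. -/
theorem leftMulAut_commute {c c' : Fin n} {w w' : FreeGroup (Fin n)}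
    (h : ∀ u, leftMulHom c u w = w) (h' : ∀ u, leftMulHom c' u w' = w') (hc : c ≠ c')
    (hw : leftMulHom c w w' = w') (hw' : leftMulHom c' w' w = w) :
    leftMulAut c w h * leftMulAut c' w' h' = leftMulAut c' w' h' * leftMulAut c w h := by
  have : (leftMulHom c w).comp (leftMulHom c' w') =
      (leftMulHom c' w').comp (leftMulHom c w) := by
    ext j : 1
    by_cases hj : j = c
    · subst hj
      simp [leftMulHom_of, hc, hw']
    · by_cases hj' : j = c'
      · subst hj'
        simp [leftMulHom_of, hj, hw]
      · simp [leftMulHom_of, hj, hj']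
  ext x
  exact DFunLike.congr_fun this x

/-- The commutator `[x_a, x_b]`. -/
def genCommutator (a b : Fin n) : FreeGroup (Fin n) :=
  FreeGroup.of a * FreeGroup.of b * (FreeGroup.of a)⁻¹ * (FreeGroup.of b)⁻¹

theorem leftMulHom_genCommutator {a b c : Fin n} (ha : a ≠ c) (hb : b ≠ c)
    (u : FreeGroup (Fin n)) : leftMulHom c u (genCommutator a b) = genCommutator a b := by
  simp [genCommutator, leftMulHom_of, ha, hb]

theorem leftMulAut_genCommutator_mem {a b c : Fin n} (h) :
    leftMulAut c (genCommutator a b) h ∈ IA n := by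
  have : (Abelianization.of (G := FreeGroup (Fin n))).comp
      (leftMulHom c (genCommutator a b)) = Abelianization.of := by
    ext j : 1
    by_cases hj : j = c
    · simp only [MonoidHom.comp_apply, leftMulHom_of, hj, genCommutator, map_mul, map_inv, if_true]
      rw [mul_comm (Abelianization.of (FreeGroup.of a))]
      simp
    · simp [leftMulHom_of, hj]
  exact fun x => DFunLike.congr_fun this x

theorem IA_conj_mem {φ : MulAut (FreeGroup (Fin n))} (hφ : φ ∈ IA n)
    (ν : MulAut (FreeGroup (Fin n))) : ν * φ * ν⁻¹ ∈ IA n := by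
  intro x
  have h : ∀ y, Abelianization.of (ν y) = Abelianization.map ν.toMonoidHom (Abelianization.of y) :=
    fun y => rfl
  calc Abelianization.of (ν (φ (ν⁻¹ x))) = Abelianization.of (ν (ν⁻¹ x)) := by
        rw [h, hφ, ← h]
    _ = Abelianization.of x := by rw [MulAut.apply_inv_self]

/-- The pairs of dual frames of `H` and its dual whose first member consists of the classes of a
basis of the free group. -/
def automorphismFrames (n : ℕ) : Set (Bool → Fin n → Fin n → ℚ) :=
  {b | DualFrames b ∧ ∃ ν : MulAut (FreeGroup (Fin n)),
    ∀ j, b false j = (cls n (ν (FreeGroup.of j))).toAdd}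

theorem cls_of (j : Fin n) : (cls n (FreeGroup.of j)).toAdd = Pi.single j 1 := by
  simp [cls]

theorem automorphismFrames_nonempty (n : ℕ) : (automorphismFrames n).Nonempty := by
  refine ⟨fun _ j => Pi.single j 1, ?_, 1, fun j => (cls_of j).symm⟩
  have : Matrix.of (fun j : Fin n => (Pi.single j 1 : Fin n → ℚ)) = 1 := by
    ext i j
    simp [Matrix.one_apply, Pi.single_apply, eq_comm]
  show Matrix.of _ * (Matrix.of _).transpose = _
  rw [this, Matrix.transpose_one, mul_one]

theorem DualFrames.transvect {b : Bool → Fin n → Fin n → ℚ} (hb : DualFrames b) {x y : Fin n}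
    (hxy : x ≠ y) (t : ℚ) : DualFrames (transvect b false x y t) := by
  have h := fun i j => hb.sum_coord (e := false) (e' := true) (by simp) i j
  have h1 : ∀ i z, AlbaneseIA.transvect b false x y t false i z =
      b false i z + (if i = x then t else 0) * b false y z := by
    intro i z
    by_cases hi : i = x <;> simp [AlbaneseIA.transvect, hi]
  have h2 : ∀ i z, AlbaneseIA.transvect b false x y t true i z =
      b true i z - (if i = y then t else 0) * b true x z := by
    intro i z
    by_cases hi : i = y <;> simp [AlbaneseIA.transvect, hi, sub_eq_add_neg]
  ext i j
  simp only [Matrix.mul_apply, Matrix.of_apply, Matrix.transpose_apply, h1, h2]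
  set p := if i = x then t else 0 with hp
  set q := if j = y then t else 0 with hq
  have : ∀ z, (b false i z + p * b false y z) * (b true j z - q * b true x z) =
      b false i z * b true j z + p * (b false y z * b true j z) - q * (b false i z * b true x z) -
        p * q * (b false y z * b true x z) := fun z => by ring
  simp only [this, Finset.sum_sub_distrib, Finset.sum_add_distrib, ← Finset.mul_sum, h]
  rw [if_neg hxy.symm, hp, hq, Matrix.one_apply]
  by_cases hj : j = y
  · by_cases hi : i = x <;> simp [hi, hj, hxy]
  · by_cases hi : i = x <;> simp [hi, hj, Ne.symm hj]

theorem transvect_true (b : Bool → Fin n → Fin n → ℚ) (x y : Fin n) (t : ℚ) :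
    transvect b true x y t = transvect b false y x (-t) := by
  funext e z
  cases e <;> simp [transvect]

/-- Precomposing `ν` with the Nielsen transformation `x_x ↦ x_y^{±1} x_x` transvects the frame of
classes; the dual frame follows. A transvection of the dual frame is one of the frame itself, with
roles exchanged and the opposite sign. -/
theorem automorphismFrames_transvectClosed (n : ℕ) : TransvectClosed (automorphismFrames n) := by
  have key : ∀ b ∈ automorphismFrames n, ∀ x y : Fin n, x ≠ y → ∀ t : ℚ, t = 1 ∨ t = -1 →
      transvect b false x y t ∈ automorphismFrames n := by
    rintro b ⟨hb, ν, hν⟩ x y hxy t ht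
    refine ⟨hb.transvect hxy t, ?_⟩
    obtain ⟨w, hw, hwt⟩ : ∃ w : FreeGroup (Fin n), (∀ u, leftMulHom x u w = w) ∧
        (cls n (ν w)).toAdd = t • b false y := by
      rcases ht with rfl | rfl
      · refine ⟨FreeGroup.of y, fun u => by simp [leftMulHom_of, hxy.symm], ?_⟩
        rw [one_smul, hν]
      · refine ⟨(FreeGroup.of y)⁻¹, fun u => by simp [leftMulHom_of, hxy.symm], ?_⟩
        rw [map_inv, map_inv, toAdd_inv, hν, neg_one_smul]
    refine ⟨ν * leftMulAut x w hw, fun j => ?_⟩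
    rw [MulAut.mul_apply, leftMulAut_apply, leftMulHom_of]
    by_cases hj : j = x
    · subst hj
      rw [transvect_apply_left, if_pos rfl, map_mul, map_mul, toAdd_mul, hwt, hν, add_comm]
    · rw [transvect_apply_of_ne _ _ (fun _ => hj) (fun h => (h rfl).elim), if_neg hj, hν]
  intro b hb e x y hxy t ht
  cases e
  · exact key b hb x y hxy t ht
  · rw [transvect_true]
    refine key b hb y x hxy.symm (-t) ?_
    rcases ht with rfl | rfl
    · exact Or.inr rfl
    · exact Or.inl (neg_neg 1)

/-- The linear form with the given coordinates. -/
def formOf (w : Fin n → ℚ) : Module.Dual ℚ (H n) := dotProductBilin ℚ ℚ w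

theorem formOf_apply (w h : Fin n → ℚ) : formOf w h = w ⬝ᵥ h := rfl

/-- The conjugate multiplies `ν(x_c)` by `[ν(x_p), ν(x_q)]` and fixes the other `ν(x_j)`. Since the
classes of the `ν(x_j)` span `H`, these values determine the Johnson image. -/
theorem johnsonFun_conj {b : Bool → Fin n → Fin n → ℚ} (hb : DualFrames b)
    {ν : MulAut (FreeGroup (Fin n))}
    (hν : ∀ j, b false j = (cls n (ν (FreeGroup.of j))).toAdd) {p q c : Fin n}
    (h : ∀ u, leftMulHom c u (genCommutator p q) = genCommutator p q)
    (hφ : ν * leftMulAut c (genCommutator p q) h * ν⁻¹ ∈ IA n) :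
    johnsonFun ⟨_, hφ⟩ = elemU n (formOf (b true c)) (b false p) (b false q) := by
  have hs := hb.span_eq_top false
  refine LinearMap.ext_on_range hs fun j => ?_
  rw [hν j, johnsonFun_cls, elemU_apply, ← hν j, formOf_apply]
  have h1 : (ν * leftMulAut c (genCommutator p q) h * ν⁻¹) (ν (FreeGroup.of j)) =
      ν (leftMulHom c (genCommutator p q) (FreeGroup.of j)) := by
    simp [leftMulAut_apply]
  have h2 : b true c ⬝ᵥ b false j = if c = j then 1 else 0 := hb.sum_coord (by simp) c j
  rw [h1, h2, leftMulHom_of]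
  by_cases hj : j = c
  · subst hj
    rw [if_pos rfl, if_pos rfl, map_mul ν, mul_inv_cancel_right, one_smul, genCommutator]
    simp only [map_mul ν, map_inv ν]
    rw [toNil2_commutator, ← hν, ← hν]
  · rw [if_neg hj, if_neg (Ne.symm hj), mul_inv_cancel, map_one, zero_smul]
    rfl

theorem johnsonAb_comp_of : (johnsonAb n).comp Abelianization.of = johnson n :=
  MonoidHom.ext fun x => Abelianization.lift_apply_of (A := Multiplicative (U n)) (johnson n) x

theorem johnsonExterior_rationalHomologyMap_of {i : ℕ} (z : rationalHomology (IA n) i) :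
    johnsonExterior n i (rationalHomologyMap Abelianization.of i z) =
      homologyToExterior (U n) i (rationalHomologyMap (johnson n) i z) := by
  rw [← johnsonAb_comp_of, rationalHomologyMap_comp, johnsonExterior]
  rfl

theorem mem_albaneseIA {i : ℕ} (g : Fin i → IA n) (hg : ∀ j k, g j * g k = g k * g j) :
    (exteriorPower.ιMulti ℚ i fun k => johnsonFun (g k)) ∈ albaneseIA n i := by
  obtain ⟨z, hz⟩ := exists_torusClass g hg
  have h := hz (U n) (johnson n)
  rw [← johnsonExterior_rationalHomologyMap_of] at h
  have h' := Submodule.mem_map_of_mem (f := johnsonExterior n i)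
    (LinearMap.mem_range_self (rationalHomologyMap (Abelianization.of (G := IA n)) i) z)
  rw [h] at h'
  exact h'

/-- Products of elementary elements of `U` for a frame coming from an automorphism of the free
group are in the Albanese homology, if the indices are distinct. -/
theorem ιMulti_elemU_mem_albaneseIA {i : ℕ} {b : Bool → Fin n → Fin n → ℚ}
    (hb : b ∈ automorphismFrames n) {p q c : Fin i → Fin n} (hc : Function.Injective c)
    (hp : ∀ j k, p j ≠ c k) (hq : ∀ j k, q j ≠ c k) :
    (exteriorPower.ιMulti ℚ i fun j =>
      elemU n (formOf (b true (c j))) (b false (p j)) (b false (q j))) ∈ albaneseIA n i := by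
  obtain ⟨hd, ν, hν⟩ := hb
  have hw : ∀ j k u, leftMulHom (c k) u (genCommutator (p j) (q j)) = genCommutator (p j) (q j) :=
    fun j k u => leftMulHom_genCommutator (hp j k) (hq j k) u
  have hmem : ∀ j, ν * leftMulAut (c j) _ (hw j j) * ν⁻¹ ∈ IA n := fun j =>
    IA_conj_mem (leftMulAut_genCommutator_mem _) ν
  have := mem_albaneseIA (fun j => ⟨_, hmem j⟩) (by
    intro j k
    by_cases hjk : j = k
    · rw [hjk]
    · have := leftMulAut_commute (hw j j) (hw k k) (hc.ne hjk) (hw k j _) (hw j k _)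
      refine Subtype.ext ?_
      show ν * _ * ν⁻¹ * (ν * _ * ν⁻¹) = ν * _ * ν⁻¹ * (ν * _ * ν⁻¹)
      rw [conj_mul, conj_mul, this])
  simpa only [johnsonFun_conj hd hν] using this

end Automorphisms

/-! ### Coordinates of mixed tensors -/

section Coordinates

variable {n : ℕ} {ι κ : Type}

/-- Linear maps on mixed tensors that agree on pure tensors are equal. -/
theorem mixedTensor_ext {W : Type} [AddCommMonoid W] [Module ℚ W]
    {F G : (⨂[ℚ] _ : ι, H n) ⊗[ℚ] (⨂[ℚ] _ : κ, Module.Dual ℚ (H n)) →ₗ[ℚ] W}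
    (h : ∀ v f, F (PiTensorProduct.tprod ℚ v ⊗ₜ[ℚ] PiTensorProduct.tprod ℚ f) =
      G (PiTensorProduct.tprod ℚ v ⊗ₜ[ℚ] PiTensorProduct.tprod ℚ f)) : F = G := by
  refine TensorProduct.ext (PiTensorProduct.ext (MultilinearMap.ext fun v => ?_))
  refine PiTensorProduct.ext (MultilinearMap.ext fun f => ?_)
  simpa using h v f

variable [Fintype ι] [Fintype κ]

/-- A coordinate of a tensor in `H^{⊗ p} ⊗ (H^*)^{⊗ q}`. -/
def tensorCoord (A : ι → Fin n) (C : κ → Fin n) :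
    (⨂[ℚ] _ : ι, H n) ⊗[ℚ] (⨂[ℚ] _ : κ, Module.Dual ℚ (H n)) →ₗ[ℚ] ℚ :=
  (TensorProduct.lid ℚ ℚ).toLinearMap ∘ₗ TensorProduct.map
    (PiTensorProduct.lift ((MultilinearMap.mkPiAlgebra ℚ ι ℚ).compLinearMap
      fun a => LinearMap.proj (A a)))
    (PiTensorProduct.lift ((MultilinearMap.mkPiAlgebra ℚ κ ℚ).compLinearMap
      fun l => LinearMap.applyₗ (Pi.single (C l) 1)))

theorem tensorCoord_tprod (A : ι → Fin n) (C : κ → Fin n) (v : ι → H n)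
    (f : κ → Module.Dual ℚ (H n)) :
    tensorCoord A C (PiTensorProduct.tprod ℚ v ⊗ₜ[ℚ] PiTensorProduct.tprod ℚ f) =
      (∏ a, v a (A a)) * ∏ l, f l (Pi.single (C l) 1) := by
  simp [tensorCoord]

/-- The standard basis tensors. -/
def basisTensor (A : ι → Fin n) (C : κ → Fin n) :
    (⨂[ℚ] _ : ι, H n) ⊗[ℚ] (⨂[ℚ] _ : κ, Module.Dual ℚ (H n)) :=
  (PiTensorProduct.tprod ℚ fun a => (Pi.single (A a) 1 : H n)) ⊗ₜ[ℚ]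
    PiTensorProduct.tprod ℚ fun l => LinearMap.proj (C l)

variable [DecidableEq ι] [DecidableEq κ]

theorem sum_tensorCoord_smul (u : (⨂[ℚ] _ : ι, H n) ⊗[ℚ] (⨂[ℚ] _ : κ, Module.Dual ℚ (H n))) :
    u = ∑ A : ι → Fin n, ∑ C : κ → Fin n, tensorCoord A C u • basisTensor A C := by
  have : (LinearMap.id : (⨂[ℚ] _ : ι, H n) ⊗[ℚ] (⨂[ℚ] _ : κ, Module.Dual ℚ (H n)) →ₗ[ℚ]
      (⨂[ℚ] _ : ι, H n) ⊗[ℚ] (⨂[ℚ] _ : κ, Module.Dual ℚ (H n))) =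
      ∑ A : ι → Fin n, ∑ C : κ → Fin n, (tensorCoord A C).smulRight (basisTensor A C) := by
    refine mixedTensor_ext fun v f => ?_
    have hv : PiTensorProduct.tprod ℚ v = ∑ A : ι → Fin n, (∏ a, v a (A a)) •
        (PiTensorProduct.tprod ℚ fun a => (Pi.single (A a) 1 : H n) : ⨂[ℚ] _ : ι, H n) := by
      have : v = fun a => ∑ x, v a x • (Pi.single x 1 : H n) := by
        funext a
        exact pi_eq_sum_univ' (v a)
      conv_lhs => rw [this]
      rw [MultilinearMap.map_sum]
      exact Finset.sum_congr rfl fun A _ => MultilinearMap.map_smul_univ _ _ _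
    have hf : PiTensorProduct.tprod ℚ f = ∑ C : κ → Fin n, (∏ l, f l (Pi.single (C l) 1)) •
        (PiTensorProduct.tprod ℚ fun l => (LinearMap.proj (C l) : Module.Dual ℚ (H n)) :
          ⨂[ℚ] _ : κ, Module.Dual ℚ (H n)) := by
      have : f = fun l => ∑ x, f l (Pi.single x 1) •
          (LinearMap.proj x : Module.Dual ℚ (H n)) := by
        funext l
        refine (Pi.basisFun ℚ (Fin n)).ext fun j => ?_
        simp [Pi.single_apply, LinearMap.sum_apply]
      conv_lhs => rw [this]
      rw [MultilinearMap.map_sum]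
      exact Finset.sum_congr rfl fun C _ => MultilinearMap.map_smul_univ _ _ _
    simp only [LinearMap.id_apply, LinearMap.sum_apply, LinearMap.smulRight_apply,
      tensorCoord_tprod]
    conv_lhs => rw [hv, hf]
    rw [TensorProduct.sum_tmul]
    refine Finset.sum_congr rfl fun A _ => ?_
    rw [TensorProduct.tmul_sum]
    refine Finset.sum_congr rfl fun C _ => ?_
    rw [TensorProduct.smul_tmul_smul, basisTensor]
  simpa using LinearMap.congr_fun this u

/-- This translates the intrinsic contraction maps into sums over a common index, the form in which
tracelessness is used for coordinates. -/
theorem tensorCoord_contraction (k : ι) (l : κ) (A : ι → Fin n) (C : κ → Fin n)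
    (u : (⨂[ℚ] _ : ι, H n) ⊗[ℚ] (⨂[ℚ] _ : κ, Module.Dual ℚ (H n))) :
    ∑ x, tensorCoord (Function.update A k x) (Function.update C l x) u =
      tensorCoord (fun a : {a : ι // a ≠ k} => A a) (fun b : {b : κ // b ≠ l} => C b)
        (contraction n k l u) := by
  have : ∑ x, tensorCoord (Function.update A k x) (Function.update C l x) =
      (tensorCoord (fun a : {a : ι // a ≠ k} => A a) (fun b : {b : κ // b ≠ l} => C b)) ∘ₗ
        contraction n k l := by
    refine mixedTensor_ext fun v f => ?_
    rw [LinearMap.comp_apply, contraction_tprod, map_smul, tensorCoord_tprod, LinearMap.sum_apply]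
    have h1 : ∀ x, ∏ a, v a (Function.update A k x a) =
        v k x * ∏ a : {a : ι // a ≠ k}, v a (A a) := by
      intro x
      rw [Fintype.prod_eq_mul_prod_subtype_ne _ k, Function.update_self]
      congr 1
      exact Finset.prod_congr rfl fun a _ => by rw [Function.update_of_ne a.2]
    have h2 : ∀ x, ∏ b, f b (Pi.single (Function.update C l x b) 1) =
        f l (Pi.single x 1) * ∏ b : {b : κ // b ≠ l}, f b (Pi.single (C b) 1) := by
      intro x
      rw [Fintype.prod_eq_mul_prod_subtype_ne _ l, Function.update_self]
      congr 1
      exact Finset.prod_congr rfl fun b _ => by rw [Function.update_of_ne b.2]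
    have h3 : f l (v k) = ∑ x, v k x * f l (Pi.single x 1) := by
      conv_lhs => rw [pi_eq_sum_univ' (v k)]
      simp
    simp only [tensorCoord_tprod, h1, h2, h3, smul_eq_mul, Finset.sum_mul]
    exact Finset.sum_congr rfl fun x _ => by ring
  simpa using LinearMap.congr_fun this u

end Coordinates

/-! ### The traceless part of `⋀^i U` in coordinates -/

section TracelessPart

variable {n i m : ℕ}

/-- The sign of a slot: `false` for a factor `H`, and `true` for a factor `H^*`. -/
def slotSign (e : Fin m ≃ (Fin i × Fin 2) ⊕ Fin i) (s : Fin m) : Bool := (e s).isRight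

/-- The coordinates of a tensor in `H^{⊗ 2i} ⊗ (H^*)^{⊗ i}`, for an enumeration of the factors. -/
def slotCoord (e : Fin m ≃ (Fin i × Fin 2) ⊕ Fin i) :
    (⨂[ℚ] _ : Fin i × Fin 2, H n) ⊗[ℚ] (⨂[ℚ] _ : Fin i, Module.Dual ℚ (H n)) →ₗ[ℚ]
      ((Fin m → Fin n) → ℚ) :=
  LinearMap.pi fun J => tensorCoord (fun a => J (e.symm (Sum.inl a)))
    (fun l => J (e.symm (Sum.inr l)))

theorem tracelessCoord_slotCoord (e : Fin m ≃ (Fin i × Fin 2) ⊕ Fin i)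
    {u : (⨂[ℚ] _ : Fin i × Fin 2, H n) ⊗[ℚ] (⨂[ℚ] _ : Fin i, Module.Dual ℚ (H n))}
    (hu : u ∈ traceless (Fin i × Fin 2) (Fin i) n) :
    TracelessCoord (slotSign e) (slotCoord e u) := by
  have key : ∀ (k : Fin i × Fin 2) (l : Fin i) (J : Fin m → Fin n),
      ∑ x, slotCoord e u (Function.update (Function.update J (e.symm (Sum.inl k)) x)
        (e.symm (Sum.inr l)) x) = 0 := by
    intro k l J
    have h1 : contraction n k l u = 0 := by
      simp only [traceless, Submodule.mem_iInf, LinearMap.mem_ker] at hu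
      exact hu k l
    have h2 := tensorCoord_contraction k l (fun a => J (e.symm (Sum.inl a)))
      (fun b => J (e.symm (Sum.inr b))) u
    rw [h1, map_zero] at h2
    rw [← h2]
    refine Finset.sum_congr rfl fun x _ => ?_
    rw [slotCoord, LinearMap.pi_apply]
    congr 2
    · funext a
      by_cases ha : a = k
      · subst ha; simp
      · simp [ha]
    · funext b
      by_cases hb : b = l
      · subst hb; simp
      · simp [hb]
  intro k l hkl J
  obtain ⟨k, rfl⟩ := e.symm.surjective k
  obtain ⟨l, rfl⟩ := e.symm.surjective l
  rcases k with k | k <;> rcases l with l | l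
  · simp [slotSign] at hkl
  · exact key k l J
  · rw [← key l k J]
    refine Finset.sum_congr rfl fun x _ => ?_
    rw [Function.update_comm (by simp)]
  · simp [slotSign] at hkl

/-- The projection `π` in coordinates. -/
def projCoord (n : ℕ) (e : Fin m ≃ (Fin i × Fin 2) ⊕ Fin i) :
    ((Fin m → Fin n) → ℚ) →ₗ[ℚ] ⋀[ℚ]^i (U n) :=
  ∑ A : Fin i × Fin 2 → Fin n, ∑ C : Fin i → Fin n,
    (LinearMap.proj fun s => Sum.elim A C (e s)).smulRight (proj n i (basisTensor A C))

theorem projCoord_slotCoord (e : Fin m ≃ (Fin i × Fin 2) ⊕ Fin i)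
    (u : (⨂[ℚ] _ : Fin i × Fin 2, H n) ⊗[ℚ] (⨂[ℚ] _ : Fin i, Module.Dual ℚ (H n))) :
    projCoord n e (slotCoord e u) = proj n i u := by
  conv_rhs => rw [sum_tensorCoord_smul u]
  simp [projCoord, slotCoord, LinearMap.sum_apply, map_sum]

theorem slotCoord_frame (e : Fin m ≃ (Fin i × Fin 2) ⊕ Fin i) (b : Bool → Fin n → Fin n → ℚ)
    (I : Fin m → Fin n) :
    slotCoord e ((PiTensorProduct.tprod ℚ fun a => b false (I (e.symm (Sum.inl a)))) ⊗ₜ[ℚ]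
      PiTensorProduct.tprod ℚ fun l => formOf (b true (I (e.symm (Sum.inr l))))) =
      frameTensor (slotSign e) b I := by
  funext J
  rw [slotCoord, LinearMap.pi_apply, tensorCoord_tprod, frameTensor, ← Equiv.prod_comp e.symm,
    Fintype.prod_sum_type]
  simp [slotSign, formOf_apply]

theorem projCoord_frameTensor (e : Fin m ≃ (Fin i × Fin 2) ⊕ Fin i)
    (b : Bool → Fin n → Fin n → ℚ) (I : Fin m → Fin n) :
    projCoord n e (frameTensor (slotSign e) b I) = exteriorPower.ιMulti ℚ i fun j =>
      elemU n (formOf (b true (I (e.symm (Sum.inr j))))) (b false (I (e.symm (Sum.inl (j, 0)))))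
        (b false (I (e.symm (Sum.inl (j, 1))))) := by
  rw [← slotCoord_frame, projCoord_slotCoord]
  exact projOf_tprod _ _ _ _

/-- For `n ≥ 3i`, the traceless part of `⋀^i U` is contained in the span of the products of
elementary elements of `U` for vectors of dual frames, where it suffices to take the frames in a set
closed under integral transvections. -/
theorem tracelessPart_le_of_frames (hn : 3 * i ≤ n) {B : Set (Bool → Fin n → Fin n → ℚ)}
    (hB : TransvectClosed B) (hd : ∀ b ∈ B, DualFrames b) (hne : B.Nonempty)
    (P : Submodule ℚ (⋀[ℚ]^i (U n)))
    (hP : ∀ b ∈ B, ∀ p q c : Fin i → Fin n, Function.Injective c → (∀ j k, p j ≠ c k) →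
      (∀ j k, q j ≠ c k) → (exteriorPower.ιMulti ℚ i fun j =>
        elemU n (formOf (b true (c j))) (b false (p j)) (b false (q j))) ∈ P) :
    tracelessPart n i ≤ P := by
  rw [tracelessPart, Submodule.map_le_iff_le_comap]
  intro u hu
  -- Any enumeration of the `3i` factors will do; the frame argument only needs the sign of each
  -- slot.
  have e : Fin (3 * i) ≃ (Fin i × Fin 2) ⊕ Fin i := Fintype.equivOfCardEq (by simp; omega)
  have hgen : ∀ w ∈ {w | ∃ b ∈ B, ∃ I : Fin (3 * i) → Fin n, Function.Injective I ∧
      w = frameTensor (slotSign e) b I}, projCoord n e w ∈ P := by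
    intro w hw
    obtain ⟨b, hb, I, hI, rfl⟩ := hw
    rw [projCoord_frameTensor]
    have hinj : Function.Injective fun s => I (e.symm s) := hI.comp e.symm.injective
    exact hP b hb (fun j => I (e.symm (Sum.inl (j, 0)))) (fun j => I (e.symm (Sum.inl (j, 1))))
      (fun j => I (e.symm (Sum.inr j))) (fun _ _ h => Sum.inr_injective (hinj h))
      (fun j k h => Sum.inl_ne_inr (hinj h)) (fun j k h => Sum.inl_ne_inr (hinj h))
  have hspan := (Submodule.span_le (p := P.comap (projCoord n e))).2 hgen
    ((tracelessCoord_slotCoord e hu).mem_span hB hd hne hn)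
  exact Eq.subst (motive := fun w => w ∈ P) (projCoord_slotCoord e u) hspan

end TracelessPart

end AlbaneseIA

end


/-- For `n ≥ 3i`, the traceless part `H_i(U, ℚ)^tl = π(T_{2i,i})` of `H_i(U, ℚ) = ⋀^i U` is
contained in the Albanese homology `H^A_i(IA_n, ℚ) ⊆ H_i(U, ℚ)`. -/
theorem theorem5p1 (n i : ℕ) (hn : 3 * i ≤ n) :
    AlbaneseIA.tracelessPart n i ≤ AlbaneseIA.albaneseIA n i := by
  exact AlbaneseIA.tracelessPart_le_of_frames hn (AlbaneseIA.automorphismFrames_transvectClosed n)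
    (fun _ hb => hb.1) (AlbaneseIA.automorphismFrames_nonempty n) _
    fun _ hb _ _ _ => AlbaneseIA.ιMulti_elemU_mem_albaneseIA hb
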